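/- \textbf{Theorem (Insertion Correctness).} \emph{NB-trees.} Fix integers $B,B'\ge 3$, $f\ge 3$ and $s\ge 2f$. An NB-tree is a tree (the s-tree) of \emph{s-nodes}, all leaves of which are on the same lowest level. Each s-node is a B$^+$-tree (its d-tree) of \emph{d-nodes}; a non-leaf d-node stores keys $K_1<\dots<K_n$ and $n+1$ pointers to d-nodes one level below, a leaf d-node stores a sorted list of key-value pairs. In a non-leaf s-node some of the stored keys are \emph{s-keys} and carry a pointer to a child s-node, and every leaf d-node carries one further pointer $P_{s\text{-}node}$ to a child s-node; all other keys are \emph{r-keys}. Leaf s-nodes store no pointers to s-nodes. The initial NB-tree is a single s-node with an empty d-tree (one empty leaf d-node). The keys of an s-node are those in its leaf d-nodes. \emph{Size requirements.} A leaf d-node has at most $B-1$ keys and, unless it is the root of its d-tree, at least $\lfloor\frac{B-1}2\rfloor$. A non-leaf d-node has at most $B'-1$ keys and, unless it is the root of its d-tree, at least $\lfloor\frac{B'-1}2\rfloor$. A non-leaf or root s-node has between $1$ and $s$ keys, any other (leaf) s-node between $\lfloor\frac s2\rfloor$ and $s$. \emph{Structural requirements.} $f\le \frac s2$; every non-leaf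 s-node has between $\lfloor\frac f2\rfloor$ and $f$ children and between $\lfloor\frac{f-1}2\rfloor$ and $f-1$ s-keys, where for the root the lower bounds are $2$ and $1$ instead. \emph{Properties.} (i) Every d-tree is a B$^+$-tree: its keys ascend from left to right, its leaf d-nodes are on one level, the keys below the $i$-th pointer of a non-leaf d-node are greater than $K_{i-1}$ and at most $K_i$, and a non-leaf root d-node has at least one key. (ii) All keys stored in the NB-tree are distinct, and distinct s-nodes have distinct addresses. (iii) Cross-s-node linkage: if $K_1<\dots<K_n$ are the s-keys of a non-leaf s-node, $K_0=-\infty$ and $K_{n+1}=+\infty$, then the s-node has exactly $n+1$ children $C_1,\dots,C_{n+1}$; $K_i$ points to $C_i$ for $1\le i\le n$; every key in $C_i$ or in an s-node below $C_i$ is greater than $K_{i-1}$ and at most $K_i$; and $P_{s\text{-}node}$ of a leaf d-node points to $C_i$, where $K_i$ is the first s-key found in the leaf d-nodes to the right of that d-node ($i=n+1$ if there is none). \emph{Insertion.} A new pair is inserted as an r-key into the root s-node. Every insertion into a d-tree is a B$^+$-tree insertion. An overfull leaf d-node is cut into its lower $\lfloor\cdot/2\rfloor$ and its upper half, the separator being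 the largest key of the lower half; an overfull non-leaf d-node is cut at its middle key, which moves up. When a leaf d-node is cut, the upper half keeps $P_{s\text{-}node}$ and the lower half gets the pointer of the smallest s-key in the upper half, or the same $P_{s\text{-}node}$ if there is none. (1) \emph{r-key into a leaf s-node}: if afterwards it has more than $s$ keys, it is split: the keys below the median form one s-node, the keys above it another, and the median is inserted as an s-key into the parent (Case 2); if the split s-node was the root, an empty non-leaf root s-node is first created as its parent. (2) \emph{s-key $K$ into a non-leaf s-node, after a child has been split into $C'$ (keys below $K$) and $C''$ (keys above $K$)}: $K$ gets a pointer to $C'$. With $K_s$ the largest s-key below $K$ and $K_l$ the smallest s-key above $K$ (or $\mp\infty$), $P_{s\text{-}node}$ is set to $C'$ in the leaf d-nodes whose largest key is in $[K_s,K)$ and to $C''$ in those whose largest key is in $[K,K_l)$. $C''$ keeps the address of the split child, $C'$ gets a new one. If afterwards there are more than $f-1$ s-keys, the s-node is split at its median s-key, together with its pointers, and that s-key is inserted as an s-key into the parent (created, as in (1), if it does not exist). (3) \emph{r-key into a non-leaf s-node}: if afterwards it has more than $s$ keys, it is merged down: all its r-keys are taken out, so that only its s-keys stay, and are then recursively inserted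 as r-keys one level below, in ascending order, each into the child whose key range contains it at that time (the smallest s-key above it, or the last $P_{s\text{-}node}$, leads to that child); every such insertion, with all splits and merges that it causes, is finished before the next begins. The d-trees of the s-nodes produced by splits and merges are built from the empty d-tree by inserting their keys in ascending order, r-keys as r-keys and s-keys as s-keys. \emph{Claim.} Let $T$ be the initial NB-tree, or an NB-tree that satisfies the size requirements, the structural requirements and the properties (i)--(iii). Let $(k,v)$ be a key-value pair whose key $k$ is not stored in $T$. Then the NB-tree obtained from $T$ by the insertion of $(k,v)$ satisfies the size requirements, the structural requirements and the properties (i)--(iii), and the pairs it stores are exactly those of $T$ together with $(k,v)$. -/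

import Mathlib

/-!  Nested B-trees (NB-trees).  Keys are ordered by a linear order on `K`; every key carries a value
in `V`.  Pointers to s-nodes are modelled by natural-number addresses; the sibling pointer of a leaf
d-node is the next leaf d-node in the left-to-right order.  All trees are indexed by their height
(height `0` = lowest level), since a pointer always leads exactly one level down. -/

namespace NBT

universe u v w

/-- `B`, `B'`: capacities of leaf and non-leaf d-nodes; `s`: size of an s-node; `f`: fanout. -/
structure Params where
  B : ℕ
  B' : ℕ
  s : ℕ
  f : ℕ

/-- A key-value pair in a leaf d-node.  It is an s-key iff it has an s-key pointer, else an r-key. -/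
structure Entry (K : Type u) (V : Type v) where
  key : K
  val : V
  ptr : Option ℕ

/-- A leaf d-node: a list of entries and the slot `P_{s-node}`. -/
structure LeafDNode (K : Type u) (V : Type v) where
  entries : List (Entry K V)
  pSnode : Option ℕ

/-- A non-leaf d-node: keys `K₁, …, Kₙ` and child d-nodes `P₁, …, Pₙ₊₁` (of type `C`). -/
structure InnerDNode (K : Type u) (C : Type w) where
  keys : List K
  kids : List C

/-- d-nodes with everything below them, by height. -/
@[reducible] def DNode (K : Type u) (V : Type v) : ℕ → Type (max u v)
  | 0 => LeafDNode K V
  | n + 1 => InnerDNode K (DNode K V n)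

/-- A data tree, given by its root d-node. -/
structure DTree (K : Type u) (V : Type v) where
  height : ℕ
  root : DNode K V height

/-- A leaf s-node: its address and its data tree. -/
structure LeafSNode (K : Type u) (V : Type v) where
  addr : ℕ
  dtree : DTree K V

/-- A non-leaf s-node: its address, its data tree and its child s-nodes (of type `C`). -/
structure InnerSNode (K : Type u) (V : Type v) (C : Type w) where
  addr : ℕ
  dtree : DTree K V
  kids : List C

/-- s-nodes with everything below them, by height. -/
@[reducible] def STree (K : Type u) (V : Type v) : ℕ → Type (max u v)
  | 0 => LeafSNode K V
  | n + 1 => InnerSNode K V (STree K V n)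

/-- An NB-tree, given by its root s-node. -/
structure NBTree (K : Type u) (V : Type v) where
  height : ℕ
  root : STree K V height

variable {K : Type u} {V : Type v}

/-! ### Contents -/

/-- The s-keys in a list of entries. -/
def sKeys (es : List (Entry K V)) : List (Entry K V) := es.filter fun e => e.ptr.isSome

/-- The r-keys in a list of entries. -/
def rKeys (es : List (Entry K V)) : List (Entry K V) := es.filter fun e => e.ptr.isNone

/-- The pointer of the first s-key of `es`, and `last` if there is none. -/
def nextPtr (es : List (Entry K V)) (last : Option ℕ) : Option ℕ :=
  match (sKeys es).head? with
  | some e => e.ptr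
  | none => last

/-- The leaf d-nodes (entries and `P_{s-node}`) from left to right. -/
def DNode.leaves : (n : ℕ) → DNode K V n → List (List (Entry K V) × Option ℕ)
  | 0, ⟨es, p⟩ => [(es, p)]
  | n + 1, ⟨_, cs⟩ => cs.flatMap fun c => DNode.leaves n c

/-- The entries in the leaf level below a d-node, from left to right. -/
def DNode.entries (n : ℕ) (t : DNode K V n) : List (Entry K V) :=
  (DNode.leaves n t).flatMap Prod.fst

def DTree.leaves (d : DTree K V) : List (List (Entry K V) × Option ℕ) := DNode.leaves d.height d.root

def DTree.entries (d : DTree K V) : List (Entry K V) := DNode.entries d.height d.root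

/-- The number of keys in the leaf level. -/
def DTree.size (d : DTree K V) : ℕ := d.entries.length

/-- `P_{s-node}` of the last leaf d-node. -/
def DTree.lastPtr (d : DTree K V) : Option ℕ :=
  match d.leaves.getLast? with
  | some l => l.2
  | none => none

/-- The address of an s-node. -/
def STree.addr : (n : ℕ) → STree K V n → ℕ
  | 0, ⟨a, _⟩ => a
  | _ + 1, ⟨a, _, _⟩ => a

/-- All entries stored in an s-node and in its descendants. -/
def STree.entries : (n : ℕ) → STree K V n → List (Entry K V)
  | 0, ⟨_, d⟩ => d.entries
  | n + 1, ⟨_, d, cs⟩ => d.entries ++ cs.flatMap fun c => STree.entries n c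

/-- The addresses of an s-node and of its descendants. -/
def STree.addrs : (n : ℕ) → STree K V n → List ℕ
  | 0, ⟨a, _⟩ => [a]
  | n + 1, ⟨a, _, cs⟩ => a :: cs.flatMap fun c => STree.addrs n c

def NBTree.entries (t : NBTree K V) : List (Entry K V) := STree.entries t.height t.root

def NBTree.keys (t : NBTree K V) : List K := t.entries.map Entry.key

/-- The stored key-value pairs. -/
def NBTree.pairs (t : NBTree K V) : List (K × V) := t.entries.map fun e => (e.key, e.val)

/-! ### Size requirements -/

/-- Size requirement for a non-root d-node and all d-nodes below it. -/
def DNode.SizeReq (p : Params) : (n : ℕ) → DNode K V n → Prop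
  | 0, ⟨es, _⟩ => (p.B - 1) / 2 ≤ es.length ∧ es.length ≤ p.B - 1
  | n + 1, ⟨ks, cs⟩ => (p.B' - 1) / 2 ≤ ks.length ∧ ks.length ≤ p.B' - 1 ∧
      ∀ c ∈ cs, DNode.SizeReq p n c

/-- d-node size requirements for a whole d-tree; the root d-node has no lower bound. -/
def DTree.SizeReq (p : Params) : DTree K V → Prop
  | ⟨0, ⟨es, _⟩⟩ => es.length ≤ p.B - 1
  | ⟨n + 1, ⟨ks, cs⟩⟩ => ks.length ≤ p.B' - 1 ∧ ∀ c ∈ cs, DNode.SizeReq p n c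

/-- Size requirements for all d-nodes and s-nodes; `isRoot` tells whether the top s-node is the root. -/
def STree.SizeReq (p : Params) : (n : ℕ) → (isRoot : Bool) → STree K V n → Prop
  | 0, isRoot, ⟨_, d⟩ => d.SizeReq p ∧ (if isRoot then 1 else p.s / 2) ≤ d.size ∧ d.size ≤ p.s
  | n + 1, _, ⟨_, d, cs⟩ => d.SizeReq p ∧ 1 ≤ d.size ∧ d.size ≤ p.s ∧
      ∀ c ∈ cs, STree.SizeReq p n false c

def NBTree.SizeRequirements (p : Params) (t : NBTree K V) : Prop :=
  STree.SizeReq p t.height true t.root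

/-! ### Structural requirements -/

/-- Bounds on the numbers of children and of s-keys of all non-leaf s-nodes. -/
def STree.StructReq (p : Params) : (n : ℕ) → (isRoot : Bool) → STree K V n → Prop
  | 0, _, _ => True
  | n + 1, isRoot, ⟨_, d, cs⟩ =>
      (if isRoot then 2 else p.f / 2) ≤ cs.length ∧ cs.length ≤ p.f ∧
      (if isRoot then 1 else (p.f - 1) / 2) ≤ (sKeys d.entries).length ∧
      (sKeys d.entries).length ≤ p.f - 1 ∧
      ∀ c ∈ cs, STree.StructReq p n false c

/-- The structural requirements, including the bound on the fanout. -/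
def NBTree.StructuralRequirements (p : Params) (t : NBTree K V) : Prop :=
  2 * p.f ≤ p.s ∧ STree.StructReq p t.height true t.root

/-! ### B⁺-tree property of the d-trees -/

section order

variable [LinearOrder K]

/-- The search-tree property below a d-node: keys are strictly increasing, a non-leaf d-node has one
child more than keys, and the keys below its `i`-th child are greater than its `(i-1)`-st key and at
most its `i`-th key. -/
def DNode.IsBPlus : (n : ℕ) → DNode K V n → Prop
  | 0, ⟨es, _⟩ => (es.map Entry.key).Pairwise (· < ·)
  | n + 1, ⟨ks, cs⟩ => ks.Pairwise (· < ·) ∧ cs.length = ks.length + 1 ∧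
      (∀ (i : ℕ) (k : K) (c : DNode K V n), ks[i]? = some k → cs[i]? = some c →
        ∀ e ∈ DNode.entries n c, e.key ≤ k) ∧
      (∀ (i : ℕ) (k : K) (c : DNode K V n), ks[i]? = some k → cs[i + 1]? = some c →
        ∀ e ∈ DNode.entries n c, k < e.key) ∧
      ∀ c ∈ cs, DNode.IsBPlus n c

/-- A d-tree is a B⁺-tree; a non-leaf root d-node has at least one key. -/
def DTree.IsBPlus : DTree K V → Prop
  | ⟨0, t⟩ => DNode.IsBPlus 0 t
  | ⟨n + 1, ⟨ks, cs⟩⟩ => ks ≠ [] ∧ DNode.IsBPlus (n + 1) ⟨ks, cs⟩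

def STree.AllBPlus : (n : ℕ) → STree K V n → Prop
  | 0, ⟨_, d⟩ => d.IsBPlus
  | n + 1, ⟨_, d, cs⟩ => d.IsBPlus ∧ ∀ c ∈ cs, STree.AllBPlus n c

/-! ### Pointers and the cross-s-node linkage property -/

/-- A d-tree in a leaf s-node stores no pointers to s-nodes. -/
def NoPointers (d : DTree K V) : Prop :=
  (∀ e ∈ d.entries, e.ptr = none) ∧ ∀ l ∈ d.leaves, l.2 = none

/-- Linkage between a non-leaf s-node with d-tree `d` and its child s-nodes `cs`.  With s-keys
`K₁ < … < Kₙ` (and `K₀ = -∞`, `Kₙ₊₁ = +∞`):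
* there are `n + 1` children, and the pointer of `Kᵢ` is the address of the `i`-th one;
* all keys in the `i`-th child, and in the s-nodes below it, are `> Kᵢ₋₁` and `≤ Kᵢ`;
* `P_{s-node}` of a leaf d-node equals the pointer of the first s-key found in the following leaf
  d-nodes, and leads to the last child if there is none. -/
def Linked {n : ℕ} (d : DTree K V) (cs : List (STree K V n)) : Prop :=
  let sk := sKeys d.entries
  let last : Option ℕ := cs.getLast?.map (STree.addr n)
  sk.map Entry.ptr ++ [last] = cs.map (fun c => some (STree.addr n c)) ∧
  (∀ (i : ℕ) (e : Entry K V) (c : STree K V n), sk[i]? = some e → cs[i]? = some c →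
    ∀ x ∈ STree.entries n c, x.key ≤ e.key) ∧
  (∀ (i : ℕ) (e : Entry K V) (c : STree K V n), sk[i]? = some e → cs[i + 1]? = some c →
    ∀ x ∈ STree.entries n c, e.key < x.key) ∧
  ∀ (j : ℕ) (l : List (Entry K V) × Option ℕ), d.leaves[j]? = some l →
    l.2 = nextPtr ((d.leaves.drop (j + 1)).flatMap Prod.fst) last

def STree.CrossLinked : (n : ℕ) → STree K V n → Prop
  | 0, ⟨_, d⟩ => NoPointers d
  | n + 1, ⟨_, d, cs⟩ => Linked d cs ∧ ∀ c ∈ cs, STree.CrossLinked n c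

/-- Every d-tree is a B⁺-tree, keys are distinct, s-nodes have distinct addresses, and the
cross-s-node linkage property holds at every s-node. -/
def NBTree.Properties (t : NBTree K V) : Prop :=
  STree.AllBPlus t.height t.root ∧ t.keys.Nodup ∧ (STree.addrs t.height t.root).Nodup ∧
  STree.CrossLinked t.height t.root

/-! ### Insertion into a d-tree -/

/-- Insertion of an entry into a list that is sorted by keys. -/
def insertSorted (e : Entry K V) : List (Entry K V) → List (Entry K V)
  | [] => [e]
  | x :: xs => if e.key < x.key then e :: x :: xs else x :: insertSorted e xs

/-- Outcome of an insertion below a d-node: one d-node, or two d-nodes with a separating key. -/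
inductive DRes (K : Type u) (V : Type v) (n : ℕ) : Type (max u v)
  | one (t : DNode K V n) : DRes K V n
  | two (l : DNode K V n) (k : K) (r : DNode K V n) : DRes K V n

/-- B⁺-tree insertion.  When a leaf d-node is split, the upper half keeps `P_{s-node}`, and the lower
half gets the pointer of the smallest s-key of the upper half, or the same pointer if there is none. -/
def DNode.insert (p : Params) (e : Entry K V) : (n : ℕ) → DNode K V n → DRes K V n
  | 0, ⟨es, q⟩ =>
      let es₁ := insertSorted e es
      if es₁.length ≤ p.B - 1 then .one ⟨es₁, q⟩
      else
        let lo := es₁.take (es₁.length / 2)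
        let hi := es₁.drop (es₁.length / 2)
        match lo.getLast? with
        | some x => .two ⟨lo, nextPtr hi q⟩ x.key ⟨hi, q⟩
        | none => .one ⟨es₁, q⟩
  | n + 1, ⟨ks, cs⟩ =>
      let i := (ks.takeWhile fun k => k < e.key).length
      match cs[i]? with
      | none => .one ⟨ks, cs⟩
      | some c =>
        match DNode.insert p e n c with
        | .one c₁ => .one ⟨ks, cs.set i c₁⟩
        | .two l k r =>
          let ks₁ := ks.take i ++ k :: ks.drop i
          let cs₁ := cs.take i ++ l :: r :: cs.drop (i + 1)
          if ks₁.length ≤ p.B' - 1 then .one ⟨ks₁, cs₁⟩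
          else
            let m := ks₁.length / 2
            match ks₁[m]? with
            | some x => .two ⟨ks₁.take m, cs₁.take (m + 1)⟩ x
                ⟨ks₁.drop (m + 1), cs₁.drop (m + 1)⟩
            | none => .one ⟨ks₁, cs₁⟩

/-- The empty d-tree, with the given `P_{s-node}`. -/
def DTree.empty (q : Option ℕ) : DTree K V := ⟨0, ⟨[], q⟩⟩

/-- B⁺-tree insertion at the root; a root split adds a level. -/
def DTree.insert (p : Params) (e : Entry K V) (d : DTree K V) : DTree K V :=
  match DNode.insert p e d.height d.root with
  | .one t => ⟨d.height, t⟩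
  | .two l k r => ⟨d.height + 1, ⟨[k], [l, r]⟩⟩

/-- Replace `P_{s-node}` in every leaf d-node. -/
def DNode.mapPtr (g : List (Entry K V) → Option ℕ → Option ℕ) : (n : ℕ) → DNode K V n → DNode K V n
  | 0, ⟨es, q⟩ => ⟨es, g es q⟩
  | n + 1, ⟨ks, cs⟩ => ⟨ks, cs.map fun c => DNode.mapPtr g n c⟩

/-- Insertion of the s-key `e` into the d-tree of a non-leaf s-node.  The pointer of `e` leads to the
lower piece of a split child, `hiPtr` to the upper piece.  Let `Kₛ` be the largest s-key below `e` and
`Kₗ` the smallest s-key above `e`.  Leaf d-nodes with largest key in `[Kₛ, e)` get the pointer to the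
lower piece, those with largest key in `[e, Kₗ)` the pointer to the upper piece. -/
def DTree.insertS (p : Params) (e : Entry K V) (hiPtr : Option ℕ) (d : DTree K V) : DTree K V :=
  let sk := sKeys d.entries
  let kS : Option K := ((sk.filter fun x => x.key < e.key).getLast?).map Entry.key
  let kL : Option K := ((sk.filter fun x => e.key < x.key).head?).map Entry.key
  let d₁ := d.insert p e
  let g : List (Entry K V) → Option ℕ → Option ℕ := fun es q =>
    match es.getLast? with
    | none => q
    | some x =>
      if x.key < e.key then
        match kS with
        | none => e.ptr
        | some k => if k ≤ x.key then e.ptr else q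
      else
        match kL with
        | none => hiPtr
        | some k => if x.key < k then hiPtr else q
  ⟨d₁.height, DNode.mapPtr g d₁.height d₁.root⟩

/-- Insert the entries one after the other, r-keys as r-keys and s-keys as s-keys.  To the right of
the last s-key the pointer is `last`. -/
def DTree.insertAll (p : Params) (last : Option ℕ) : List (Entry K V) → DTree K V → DTree K V
  | [], d => d
  | e :: es, d =>
      DTree.insertAll p last es
        (if e.ptr.isSome then d.insertS p e (nextPtr es last) else d.insert p e)

/-- The d-tree of a new s-node, obtained from the empty one by inserting the entries. -/
def DTree.build (p : Params) (last : Option ℕ) (es : List (Entry K V)) : DTree K V :=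
  DTree.insertAll p last es (DTree.empty (nextPtr es last))

/-! ### Insertion into an NB-tree -/

/-- Outcome of an insertion below an s-node: one s-node, or two s-nodes with the promoted median. -/
inductive SRes (K : Type u) (V : Type v) (n : ℕ) : Type (max u v)
  | one (t : STree K V n) : SRes K V n
  | two (l : STree K V n) (k : K) (x : V) (r : STree K V n) : SRes K V n

/-- Pointer to the child for the key `k`: that of the smallest s-key greater than `k`, and
`P_{s-node}` of the last leaf d-node if there is no such s-key. -/
def DTree.route (d : DTree K V) (k : K) : Option ℕ :=
  nextPtr ((sKeys d.entries).filter fun e => k < e.key) d.lastPtr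

/-- Split of a leaf s-node.  The upper piece keeps the address, the lower one gets address `a`. -/
def splitLeaf (p : Params) (a addr : ℕ) (d : DTree K V) : SRes K V 0 :=
  let es := d.entries
  let m := es.length / 2
  match es[m]? with
  | some x => .two ⟨a, DTree.build p none (es.take m)⟩ x.key x.val
      ⟨addr, DTree.build p none (es.drop (m + 1))⟩
  | none => .one ⟨addr, d⟩

/-- Split of a non-leaf s-node at the median of its s-keys. -/
def splitNode (p : Params) (a addr : ℕ) {n : ℕ} (d : DTree K V) (cs : List (STree K V n)) :
    SRes K V (n + 1) :=
  let es := d.entries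
  let m := (sKeys es).length / 2
  match (sKeys es)[m]? with
  | some x =>
      .two ⟨a, DTree.build p x.ptr (es.filter fun e => e.key < x.key), cs.take (m + 1)⟩
        x.key x.val
        ⟨addr, DTree.build p d.lastPtr (es.filter fun e => x.key < e.key), cs.drop (m + 1)⟩
  | none => .one ⟨addr, d, cs⟩

/-- Insertion of `e` as an r-key into the s-node at height `h` on the search path of `e`.
* A leaf s-node that becomes oversize is split, and its median is inserted as an s-key into the parent.
* A non-leaf s-node that becomes oversize is merged down: only its s-keys stay, and its r-keys are
  returned in the second component, to be inserted one level below.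
* A non-leaf s-node that gets more than `f - 1` s-keys is split, and the median s-key is inserted as
  an s-key into the parent.
Unused addresses are `a, a + 1, …`; a split at height `n` uses `a + n`. -/
def STree.insertAt (p : Params) (a h : ℕ) (e : Entry K V) :
    (n : ℕ) → STree K V n → SRes K V n × List (Entry K V)
  | 0, ⟨addr, d⟩ =>
      let d₁ := d.insert p e
      if d₁.size ≤ p.s then (.one ⟨addr, d₁⟩, []) else (splitLeaf p a addr d₁, [])
  | n + 1, ⟨addr, d, cs⟩ =>
      if h = n + 1 then
        let d₁ := d.insert p e
        if d₁.size ≤ p.s then (.one ⟨addr, d₁, cs⟩, [])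
        else (.one ⟨addr, DTree.build p d₁.lastPtr (sKeys d₁.entries), cs⟩, rKeys d₁.entries)
      else
        let i := cs.findIdx fun c => d.route e.key = some (STree.addr n c)
        match cs[i]? with
        | none => (.one ⟨addr, d, cs⟩, [])
        | some c =>
          match STree.insertAt p a h e n c with
          | (.one c₁, flushed) => (.one ⟨addr, d, cs.set i c₁⟩, flushed)
          | (.two l k x r, flushed) =>
            let d₁ := d.insertS p ⟨k, x, some (STree.addr n l)⟩ (some (STree.addr n r))
            let cs₁ := cs.take i ++ l :: r :: cs.drop (i + 1)
            if (sKeys d₁.entries).length ≤ p.f - 1 then (.one ⟨addr, d₁, cs₁⟩, flushed)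
            else (splitNode p (a + (n + 1)) addr d₁ cs₁, flushed)

/-- The same for an NB-tree; when the root s-node is split, a new root s-node is created. -/
def NBTree.insertAt (p : Params) (h : ℕ) (e : Entry K V) (t : NBTree K V) :
    NBTree K V × List (Entry K V) :=
  let a := (STree.addrs t.height t.root).foldr max 0 + 1
  match STree.insertAt p a h e t.height t.root with
  | (.one r, flushed) => (⟨t.height, r⟩, flushed)
  | (.two l k x r, flushed) =>
      (⟨t.height + 1, ⟨a + t.height + 1, (DTree.empty none).insertS p ⟨k, x, some (STree.addr t.height l)⟩
          (some (STree.addr t.height r)), [l, r]⟩⟩, flushed)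

/-- Recursive insertion of `e` as an r-key at height `h`.  If the s-node is merged down, its r-keys
are recursively inserted one level below, in ascending order, each insertion being finished (with all
splits and merges that it causes) before the next one starts. -/
def NBTree.insertRec (p : Params) : ℕ → Entry K V → NBTree K V → NBTree K V
  | 0, e, t => (t.insertAt p 0 e).1
  | h + 1, e, t =>
      let r := t.insertAt p (h + 1) e
      r.2.foldl (fun t₁ e₁ => NBTree.insertRec p h e₁ t₁) r.1

/-- Insertion of a key-value pair: it is inserted as an r-key into the root s-node. -/
def NBTree.insert (p : Params) (k : K) (x : V) (t : NBTree K V) : NBTree K V :=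
  NBTree.insertRec p t.height ⟨k, x, none⟩ t

end order

/-- The initial NB-tree: one s-node, whose d-tree is empty. -/
def NBTree.initial (a : ℕ) : NBTree K V := ⟨0, ⟨a, DTree.empty none⟩⟩

end NBT

namespace NBT

universe u v w

variable {K : Type u} {V : Type v}

/-! ### Pointers to the next s-key -/

/-! The proof maintains an invariant, `NBTree.OK`, through every single `insertAt` of the recursion.
On trees that store a key it implies all requirements (`STree.OK.requirements`). It also admits the
empty initial tree, so both alternatives of the hypothesis start from it.

Inside one d-tree, an insertion changes the sequence of leaf d-nodes at one place only
(`LeavesStep`, `DNode.insertSpec`). An r-key has no pointer, so it never changes which s-key comes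
next, and every `P_{s-node}` stays right. For an s-key `e`, the plain insertion leaves pointers that
are right with `e` either counted or disregarded (`PtrNear`). Resetting exactly the leaf d-nodes
between the two adjacent s-keys then makes all of them right (`ptrOK_map_newPtr`,
`DTree.OK.insertS`).

The difficulty in the s-tree is that a merge takes r-keys out of the tree and puts them back one at
a time, while each of these insertions may split and merge other s-nodes. What keeps this under
control is `PathClean h y`: above height `h`, the search path of `y` meets only s-nodes without
r-keys. An s-node that receives a promoted s-key is therefore clean. Its size is its number of
s-keys, so it is at most `f ≤ s`, and when it overflows it has exactly `f` s-keys, whose median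
leaves enough on both sides (`splitNode_spec`). A merge at height `h` cleans its s-node, so each
removed key has a path that is clean above `h - 1`. Moreover, an insertion that starts at height `h`
adds only s-keys above `h`. Hence it preserves `PathClean h' y` for every `h' ≥ h` and every `y`, in
particular for the keys that still wait (`NBTree.foldl_spec`). The recursion on the height closes
with this statement (`NBTree.insertRec_spec`).

Global properties come from counting. Stored pairs together with waiting pairs form, up to
permutation, the old pairs and the new one, which gives both the distinctness of keys and the final
claim about contents. The addresses created by one `insertAt` are fresh and belong to different
heights (`AddrExt`). -/

@[simp] theorem nextPtr_nil (q : Option ℕ) : nextPtr ([] : List (Entry K V)) q = q := rfl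

@[simp] theorem nextPtr_cons (e : Entry K V) (es : List (Entry K V)) (q : Option ℕ) :
    nextPtr (e :: es) q = e.ptr.or (nextPtr es q) := by
  unfold nextPtr sKeys
  cases h : e.ptr <;> simp [h]

@[simp] theorem nextPtr_append (as bs : List (Entry K V)) (q : Option ℕ) :
    nextPtr (as ++ bs) q = nextPtr as (nextPtr bs q) := by
  induction as with
  | nil => rfl
  | cons e es ih => simp [ih]

theorem nextPtr_of_forall_none {es : List (Entry K V)} (h : ∀ e ∈ es, e.ptr = none)
    (q : Option ℕ) : nextPtr es q = q := by
  induction es with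
  | nil => rfl
  | cons e es ih =>
    rw [nextPtr_cons, h e (by simp), ih fun x hx => h x (by simp [hx])]; rfl

theorem nextPtr_of_exists_isSome {es : List (Entry K V)} (h : ∃ e ∈ es, e.ptr.isSome)
    (q q' : Option ℕ) : nextPtr es q = nextPtr es q' := by
  induction es with
  | nil => simp at h
  | cons e es ih =>
    cases he : e.ptr with
    | some a => simp [he]
    | none =>
      simp only [List.mem_cons, exists_eq_or_imp, he] at h
      simpa [he] using ih (by simpa using h)

/-- Used to read the linkage equation from some child onwards: the address of that child is the
pointer of the next s-key, or the last pointer. -/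
theorem head?_map_ptr_append (es : List (Entry K V)) (h : ∀ e ∈ es, e.ptr.isSome)
    (q : Option ℕ) : (es.map Entry.ptr ++ [q]).head? = some (nextPtr es q) := by
  cases es with
  | nil => rfl
  | cons e es =>
    obtain ⟨a, ha⟩ := Option.isSome_iff_exists.1 (h e (by simp))
    simp [ha]

theorem sKeys_eq_self {es : List (Entry K V)} (h : ∀ e ∈ es, e.ptr.isSome) : sKeys es = es := by
  simpa [sKeys, List.filter_eq_self] using h

@[simp] theorem sKeys_sKeys (es : List (Entry K V)) : sKeys (sKeys es) = sKeys es := by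
  simp [sKeys, List.filter_filter]

theorem sKeys_perm_rKeys (es : List (Entry K V)) : (sKeys es ++ rKeys es).Perm es := by
  have := List.filter_append_perm (fun e : Entry K V => e.ptr.isSome) es
  simpa [sKeys, rKeys] using this

/-- `P_{s-node}` of every leaf d-node leads to the next s-key, or to `last`. -/
def PtrOK (last : Option ℕ) : List (List (Entry K V) × Option ℕ) → Prop
  | [] => True
  | l :: ls => l.2 = nextPtr (ls.flatMap Prod.fst) last ∧ PtrOK last ls

theorem ptrOK_iff (last : Option ℕ) (ls : List (List (Entry K V) × Option ℕ)) :
    PtrOK last ls ↔ ∀ (j : ℕ) (l : List (Entry K V) × Option ℕ), ls[j]? = some l →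
      l.2 = nextPtr ((ls.drop (j + 1)).flatMap Prod.fst) last := by
  induction ls with
  | nil => simp [PtrOK]
  | cons a ls ih =>
    rw [PtrOK, ih]
    constructor
    · rintro ⟨h1, h2⟩ (_ | j) l hl
      · simp only [List.getElem?_cons_zero, Option.some.injEq] at hl
        subst hl; simpa using h1
      · simpa using h2 j l (by simpa using hl)
    · intro h
      refine ⟨by simpa using h 0 a rfl, fun j l hl => ?_⟩
      simpa using h (j + 1) l (by simpa using hl)

/-- Leaf d-nodes on the right influence those on the left only through their first s-key, whose
pointer can thus serve as the default of the left part. -/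
theorem ptrOK_append (last : Option ℕ) (as bs : List (List (Entry K V) × Option ℕ)) :
    PtrOK last (as ++ bs) ↔ PtrOK (nextPtr (bs.flatMap Prod.fst) last) as ∧ PtrOK last bs := by
  induction as with
  | nil => simp [PtrOK]
  | cons a as ih => simp [PtrOK, ih, and_assoc]

section order

variable [LinearOrder K]

/-! ### Sorted lists of entries -/

/-- Entries in strictly ascending order of their keys. -/
def Ascending (es : List (Entry K V)) : Prop := es.Pairwise fun a b => a.key < b.key

theorem ascending_iff (es : List (Entry K V)) :
    Ascending es ↔ (es.map Entry.key).Pairwise (· < ·) := by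
  rw [Ascending, List.pairwise_map]

theorem insertSorted_append {e : Entry K V} {as bs : List (Entry K V)}
    (ha : ∀ x ∈ as, x.key < e.key) (hb : ∀ x ∈ bs, e.key < x.key) :
    insertSorted e (as ++ bs) = as ++ e :: bs := by
  induction as with
  | nil =>
    cases bs with
    | nil => rfl
    | cons b bs => simp [insertSorted, hb b (by simp)]
  | cons a as ih =>
    have := ha a (by simp)
    simp [insertSorted, not_lt.2 this.le, ih fun x hx => ha x (by simp [hx])]

theorem Ascending.exists_cut {es : List (Entry K V)} (h : Ascending es) {y : K}
    (hy : ∀ x ∈ es, x.key ≠ y) : ∃ as bs, es = as ++ bs ∧ (∀ x ∈ as, x.key < y) ∧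
      ∀ x ∈ bs, y < x.key := by
  induction es with
  | nil => exact ⟨[], [], rfl, by simp, by simp⟩
  | cons a es ih =>
    rw [Ascending, List.pairwise_cons] at h
    rcases lt_or_gt_of_ne (hy a (by simp)) with ha | ha
    · obtain ⟨as, bs, rfl, h1, h2⟩ := ih h.2 fun x hx => hy x (by simp [hx])
      exact ⟨a :: as, bs, rfl, by simpa [ha] using h1, h2⟩
    · exact ⟨[], a :: es, rfl, by simp, by simpa [ha] using fun x hx => ha.trans (h.1 x hx)⟩

theorem insertSorted_perm (e : Entry K V) (es : List (Entry K V)) :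
    (insertSorted e es).Perm (e :: es) := by
  induction es with
  | nil => exact .refl _
  | cons a es ih =>
    rw [insertSorted]
    split
    · exact .refl _
    · exact (ih.cons a).trans (.swap _ _ _)

@[simp] theorem length_insertSorted (e : Entry K V) (es : List (Entry K V)) :
    (insertSorted e es).length = es.length + 1 := (insertSorted_perm e es).length_eq

@[simp] theorem mem_insertSorted {e x : Entry K V} {es : List (Entry K V)} :
    x ∈ insertSorted e es ↔ x = e ∨ x ∈ es := by
  simp [(insertSorted_perm e es).mem_iff]

theorem Ascending.insertSorted {e : Entry K V} {es : List (Entry K V)} (h : Ascending es)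
    (he : ∀ x ∈ es, x.key ≠ e.key) : Ascending (insertSorted e es) := by
  obtain ⟨as, bs, rfl, h1, h2⟩ := h.exists_cut he
  rw [insertSorted_append h1 h2]
  simp only [Ascending, List.pairwise_append, List.pairwise_cons, List.mem_cons] at h ⊢
  refine ⟨h.1, ⟨h2, h.2.1⟩, ?_⟩
  rintro a ha b (rfl | hb)
  · exact h1 a ha
  · exact h.2.2 a ha b hb

theorem nextPtr_insertSorted {e : Entry K V} (he : e.ptr = none) (es : List (Entry K V))
    (q : Option ℕ) : nextPtr (insertSorted e es) q = nextPtr es q := by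
  induction es with
  | nil => simp [insertSorted, he]
  | cons a es ih =>
    rw [insertSorted]
    split <;> simp [he, ih]

theorem sKeys_insertSorted {e : Entry K V} (he : e.ptr = none) (es : List (Entry K V)) :
    sKeys (insertSorted e es) = sKeys es := by
  induction es with
  | nil => simp [insertSorted, sKeys, he]
  | cons a es ih =>
    rw [insertSorted]
    unfold sKeys at *
    split <;> simp [he, List.filter_cons, ih]

theorem filter_lt_of_ascending {as bs : List (Entry K V)} {x : Entry K V}
    (h : Ascending (as ++ x :: bs)) :
    (as ++ x :: bs).filter (fun e => e.key < x.key) = as ∧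
      (as ++ x :: bs).filter (fun e => x.key < e.key) = bs := by
  simp only [Ascending, List.pairwise_append, List.pairwise_cons, List.mem_cons] at h
  obtain ⟨-, ⟨h1, -⟩, h2⟩ := h
  have ha : ∀ a ∈ as, a.key < x.key := fun a m => h2 a m x (.inl rfl)
  constructor
  · rw [List.filter_append, List.filter_eq_self.2 (by simpa using ha),
      List.filter_eq_nil_iff.2, List.append_nil]
    simpa using fun b m => (h1 b m).le
  · rw [List.filter_append, List.filter_eq_nil_iff.2 (by simpa using fun a m => (ha a m).le),
      List.filter_cons_of_neg (by simp), List.filter_eq_self.2 (by simpa using h1), List.nil_append]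

/-! ### Keys that separate lists of entries -/

variable {α : Type w}

/-- The `i`-th key is at least all keys in the `i`-th list and below all following keys and all keys
in the following lists. -/
def Sep (F : α → List (Entry K V)) : List K → List α → Prop
  | [], _ => True
  | _ :: _, [] => False
  | k :: ks, c :: cs => (∀ e ∈ F c, e.key ≤ k) ∧ (∀ k' ∈ ks, k < k') ∧
      (∀ c' ∈ cs, ∀ e ∈ F c', k < e.key) ∧ Sep F ks cs

variable {F : α → List (Entry K V)}

theorem sep_append {kl kr : List K} {cl cr : List α} (h : kl.length = cl.length) :
    Sep F (kl ++ kr) (cl ++ cr) ↔ Sep F kl cl ∧ Sep F kr cr ∧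
      ∀ k ∈ kl, (∀ k' ∈ kr, k < k') ∧ ∀ c ∈ cr, ∀ e ∈ F c, k < e.key := by
  induction kl generalizing cl with
  | nil =>
    obtain rfl : cl = [] := List.length_eq_zero_iff.1 h.symm
    simp [Sep]
  | cons k kl ih =>
    cases cl with
    | nil => simp at h
    | cons c cl =>
      have := ih (cl := cl) (by simpa using h)
      simp only [List.cons_append, Sep, this, List.mem_append, List.mem_cons, or_imp, forall_and,
        forall_eq]
      tauto

theorem Sep.pairwise {ks : List K} {cs : List α} (h : Sep F ks cs) : ks.Pairwise (· < ·) := by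
  induction ks generalizing cs with
  | nil => exact .nil
  | cons k ks ih =>
    cases cs with
    | nil => exact h.elim
    | cons c cs => exact .cons h.2.1 (ih h.2.2.2)

theorem Sep.exists_le {ks : List K} {cs : List α} (h : Sep F ks cs) (hl : ks.length = cs.length)
    {c : α} (hc : c ∈ cs) : ∃ k ∈ ks, ∀ e ∈ F c, e.key ≤ k := by
  induction ks generalizing cs with
  | nil => simp [List.length_eq_zero_iff.1 hl.symm] at hc
  | cons k ks ih =>
    cases cs with
    | nil => exact h.elim
    | cons c' cs =>
      rcases List.mem_cons.1 hc with rfl | hc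
      · exact ⟨k, by simp, h.1⟩
      · obtain ⟨k', hk, h'⟩ := ih h.2.2.2 (by simpa using hl) hc
        exact ⟨k', by simp [hk], h'⟩

/-- The indexed conditions compare a child only with its two neighbouring keys; monotonicity of the
keys extends this to all later children, which makes the condition recursive. -/
theorem sep_iff_getElem? {ks : List K} {cs : List α} (hl : cs.length = ks.length + 1) :
    Sep F ks cs ↔ ks.Pairwise (· < ·) ∧
      (∀ (i : ℕ) (k : K) (c : α), ks[i]? = some k → cs[i]? = some c → ∀ e ∈ F c, e.key ≤ k) ∧
      (∀ (i : ℕ) (k : K) (c : α), ks[i]? = some k → cs[i + 1]? = some c →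
        ∀ e ∈ F c, k < e.key) := by
  induction ks generalizing cs with
  | nil => simp [Sep]
  | cons k ks ih =>
    cases cs with
    | nil => simp at hl
    | cons c cs =>
      rw [Sep, ih (by simpa using hl), List.pairwise_cons]
      constructor
      · rintro ⟨h1, h2, h3, h4, h5, h6⟩
        refine ⟨⟨h2, h4⟩, ?_, ?_⟩
        · rintro (_ | i) k' c' hk hc
          · simp only [List.getElem?_cons_zero, Option.some.injEq] at hk hc
            subst hk hc; exact h1
          · exact h5 i k' c' (by simpa using hk) (by simpa using hc)
        · rintro (_ | i) k' c' hk hc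
          · simp only [List.getElem?_cons_zero, Option.some.injEq] at hk
            subst hk
            exact h3 c' (List.mem_of_getElem? (by simpa using hc))
          · exact h6 i k' c' (by simpa using hk) (by simpa using hc)
      · rintro ⟨⟨h1, h2⟩, h3, h4⟩
        refine ⟨h3 0 k c rfl rfl, h1, ?_, h2, fun i k' c' hk hc => h3 (i + 1) k' c' hk hc,
          fun i k' c' hk hc => h4 (i + 1) k' c' hk hc⟩
        intro c' hc e he
        obtain ⟨i, hi⟩ := List.getElem?_of_mem hc
        cases i with
        | zero => exact h4 0 k c' rfl hi e he
        | succ i =>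
          have hlt : i < ks.length := by
            have := (List.getElem?_eq_some_iff.1 hi).1
            simp at hl; omega
          exact (h1 _ (List.getElem_mem hlt)).trans
            (h4 (i + 1) ks[i] c' (by simp [hlt]) (by simpa using hi) e he)

/-- The only new key `y` already lies in the interval of `c`. That interval is open on the left and
closed on the right, whence the asymmetric bounds. -/
theorem Sep.replace {kl kr : List K} {cl cr : List α} {c c' : α} {y : K}
    (hl : kl.length = cl.length) (h : Sep F (kl ++ kr) (cl ++ c :: cr))
    (hkl : ∀ k ∈ kl, k < y) (hkr : ∀ k ∈ kr, y ≤ k)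
    (hc : ∀ e ∈ F c', e.key = y ∨ ∃ x ∈ F c, x.key = e.key) :
    Sep F (kl ++ kr) (cl ++ c' :: cr) := by
  rw [sep_append hl] at h ⊢
  obtain ⟨h1, h2, h3⟩ := h
  refine ⟨h1, ?_, fun k hk => ⟨(h3 k hk).1, fun d hd e he => ?_⟩⟩
  · cases kr with
    | nil => trivial
    | cons k kr =>
      refine ⟨fun e he => ?_, h2.2⟩
      rcases hc e he with h | ⟨x, hx, h⟩
      · exact h ▸ hkr k (by simp)
      · exact h ▸ h2.1 x hx
  · rcases List.mem_cons.1 hd with rfl | hd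
    · rcases hc e he with h | ⟨x, hx, h⟩
      · exact h ▸ hkl k hk
      · exact h ▸ (h3 k hk).2 c (by simp) x hx
    · exact (h3 k hk).2 d (by simp [hd]) e he

/-- Nonemptiness of both pieces locates the new separator: a key of the lower piece forces `k` above
the separators on the left, and a key of the upper piece forces it strictly below those on the
right. -/
theorem Sep.replace_two {kl kr : List K} {cl cr : List α} {c l r : α} {y k : K}
    (hl : kl.length = cl.length) (hr : kr.length = cr.length)
    (h : Sep F (kl ++ kr) (cl ++ c :: cr))
    (hkl : ∀ k ∈ kl, k < y) (hkr : ∀ k ∈ kr, y ≤ k)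
    (hcl : ∀ e ∈ F l, e.key = y ∨ ∃ x ∈ F c, x.key = e.key)
    (hcr : ∀ e ∈ F r, e.key = y ∨ ∃ x ∈ F c, x.key = e.key)
    (hlk : ∀ e ∈ F l, e.key ≤ k) (hrk : ∀ e ∈ F r, k < e.key)
    (hl0 : F l ≠ []) (hr0 : F r ≠ []) :
    Sep F (kl ++ k :: kr) (cl ++ l :: r :: cr) ∧ (∀ k' ∈ kl, k' < k) ∧ ∀ k' ∈ kr, k < k' := by
  have hL := h.replace hl hkl hkr hcl
  have hR := h.replace hl hkl hkr hcr
  rw [sep_append hl] at hL hR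
  rw [sep_append hl]
  obtain ⟨a, ha⟩ := List.exists_mem_of_ne_nil _ hl0
  obtain ⟨b, hb⟩ := List.exists_mem_of_ne_nil _ hr0
  have hkr' : ∀ k' ∈ kr, k < k' := by
    cases kr with
    | nil => simp
    | cons k' kr =>
      have h1 := (hrk b hb).trans_le (hR.2.1.1 b hb)
      simpa [h1] using fun x hx => h1.trans (hR.2.1.2.1 x hx)
  have hkl' : ∀ k' ∈ kl, k' < k := fun k' hk =>
    ((hL.2.2 k' hk).2 l (by simp) a ha).trans_le (hlk a ha)
  refine ⟨⟨hL.1, ⟨hlk, hkr', ?_, hR.2.1⟩, fun k' hk => ⟨?_, ?_⟩⟩, hkl', hkr'⟩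
  · intro c' hc' e he
    rcases List.mem_cons.1 hc' with rfl | hc'
    · exact hrk e he
    · cases kr with
      | nil => simp [List.length_eq_zero_iff.1 hr.symm] at hc'
      | cons k' kr => exact (hkr' k' (by simp)).trans (hR.2.1.2.2.1 c' hc' e he)
  · intro x hx
    rcases List.mem_cons.1 hx with rfl | hx
    · exact hkl' k' hk
    · exact (hL.2.2 k' hk).1 x hx
  · intro c' hc' e he
    rcases List.mem_cons.1 hc' with rfl | hc'
    · exact (hL.2.2 k' hk).2 c' (by simp) e he
    · exact (hR.2.2 k' hk).2 c' hc' e he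

/-- A child left of the cut is bounded by its own separator, which is below `x`; only the child `c`
next to the cut is bounded by `x` itself. -/
theorem Sep.split {kl kr : List K} {cl cr : List α} {c : α} {x : K}
    (hl : kl.length = cl.length) (h : Sep F (kl ++ x :: kr) (cl ++ c :: cr)) :
    Sep F kl (cl ++ [c]) ∧ Sep F kr cr ∧ (∀ c' ∈ cl ++ [c], ∀ e ∈ F c', e.key ≤ x) ∧
      ∀ c' ∈ cr, ∀ e ∈ F c', x < e.key := by
  rw [sep_append hl] at h
  obtain ⟨h1, h2, h3⟩ := h
  refine ⟨?_, h2.2.2.2, ?_, h2.2.2.1⟩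
  · rw [← List.append_nil kl, sep_append hl]
    exact ⟨h1, trivial, fun k hk => ⟨by simp, fun c' hc' => (h3 k hk).2 c' (by simp_all)⟩⟩
  · intro c' hc' e he
    rcases List.mem_append.1 hc' with hc' | hc'
    · obtain ⟨k, hk, h⟩ := h1.exists_le hl hc'
      exact (h e he).trans ((h3 k hk).1 x (by simp)).le
    · rw [List.mem_singleton.1 hc'] at he
      exact h2.1 e he

theorem Sep.lt_of_mem_left {kl kr : List K} {cl cr : List α} {y : K}
    (hl : kl.length = cl.length) (h : Sep F (kl ++ kr) (cl ++ cr)) (hkl : ∀ k ∈ kl, k < y)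
    {c : α} (hc : c ∈ cl) {e : Entry K V} (he : e ∈ F c) : e.key < y := by
  obtain ⟨k, hk, h'⟩ := ((sep_append hl).1 h).1.exists_le hl hc
  exact (h' e he).trans_lt (hkl k hk)

theorem Sep.lt_of_mem_right {kl kr : List K} {cl cr : List α} {c : α} {y : K}
    (hl : kl.length = cl.length) (hr : kr.length = cr.length)
    (h : Sep F (kl ++ kr) (cl ++ c :: cr)) (hkr : ∀ k ∈ kr, y ≤ k)
    {c' : α} (hc : c' ∈ cr) {e : Entry K V} (he : e ∈ F c') : y < e.key := by
  cases kr with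
  | nil => simp [List.length_eq_zero_iff.1 hr.symm] at hc
  | cons k kr =>
    exact (hkr k (by simp)).trans_lt (((sep_append hl).1 h).2.1.2.2.1 c' hc e he)

theorem takeWhile_lt_append {ks : List K} (h : ks.Pairwise (· < ·)) (y : K) :
    ∃ kl kr, ks = kl ++ kr ∧ ks.takeWhile (fun k => decide (k < y)) = kl ∧ (∀ k ∈ kl, k < y) ∧
      ∀ k ∈ kr, y ≤ k := by
  induction ks with
  | nil => exact ⟨[], [], rfl, rfl, by simp, by simp⟩
  | cons k ks ih =>
    rw [List.pairwise_cons] at h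
    by_cases hk : k < y
    · obtain ⟨kl, kr, h1, h2, h3, h4⟩ := ih h.2
      exact ⟨k :: kl, kr, by simp [h1], by simp [hk, h2], by simpa [hk] using h3, h4⟩
    · refine ⟨[], k :: ks, rfl, by simp [hk], by simp, ?_⟩
      have := not_lt.1 hk
      simpa [this] using fun x hx => this.trans (h.1 x hx).le

end order

theorem exists_append_cons {α : Type w} (cs : List α) (i : ℕ) (h : i < cs.length) :
    ∃ cl c cr, cs = cl ++ c :: cr ∧ cl.length = i :=
  ⟨cs.take i, cs[i], cs.drop (i + 1), by simp, by simp; omega⟩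

/-! ### d-nodes -/

/-- Size requirement for a root d-node of height `n`. -/
def DNode.RootSizeReq (p : Params) : (n : ℕ) → DNode K V n → Prop
  | 0, ⟨es, _⟩ => es.length ≤ p.B - 1
  | n + 1, ⟨ks, cs⟩ => ks.length ≤ p.B' - 1 ∧ ∀ c ∈ cs, DNode.SizeReq p n c

/-- A non-leaf d-node has at least one key. -/
def DNode.HasKey : (n : ℕ) → DNode K V n → Prop
  | 0, _ => True
  | _ + 1, ⟨ks, _⟩ => ks ≠ []

theorem DNode.SizeReq.rootSizeReq {p : Params} : {n : ℕ} → {t : DNode K V n} →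
    DNode.SizeReq p n t → DNode.RootSizeReq p n t
  | 0, ⟨_, _⟩, h => h.2
  | _ + 1, ⟨_, _⟩, h => h.2

theorem DTree.sizeReq_iff (p : Params) (d : DTree K V) :
    d.SizeReq p ↔ DNode.RootSizeReq p d.height d.root := by
  obtain ⟨_ | n, t⟩ := d <;> rfl

theorem DNode.entries_succ {n : ℕ} (ks : List K) (cs : List (DNode K V n)) :
    DNode.entries (n + 1) ⟨ks, cs⟩ = cs.flatMap fun c => DNode.entries n c := by
  simp [DNode.entries, DNode.leaves, List.flatMap_assoc]

theorem DNode.entries_zero (es : List (Entry K V)) (q : Option ℕ) :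
    DNode.entries 0 (⟨es, q⟩ : DNode K V 0) = es := by
  simp [DNode.entries, DNode.leaves]

theorem DNode.mem_entries_succ {n : ℕ} {ks : List K} {cs : List (DNode K V n)} {e : Entry K V} :
    e ∈ DNode.entries (n + 1) ⟨ks, cs⟩ ↔ ∃ c ∈ cs, e ∈ DNode.entries n c := by
  simp [DNode.entries_succ]

/-- `B ≥ 3` makes the lower bound of a non-root leaf d-node positive. The pointer update for s-keys
needs this, since it inspects the largest key of each leaf d-node. -/
theorem DNode.leaves_ne_nil {p : Params} (hB : 3 ≤ p.B) : {n : ℕ} → {t : DNode K V n} →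
    DNode.SizeReq p n t → ∀ l ∈ DNode.leaves n t, l.1 ≠ []
  | 0, ⟨es, q⟩, h => by
    simp only [DNode.leaves, List.mem_singleton, forall_eq]
    rintro rfl
    have := h.1
    simp at this; omega
  | n + 1, ⟨ks, cs⟩, h => by
    simp only [DNode.leaves, List.mem_flatMap]
    rintro l ⟨c, hc, hl⟩
    exact DNode.leaves_ne_nil hB (h.2.2 c hc) l hl

theorem DNode.RootSizeReq.leaves_ne_nil {p : Params} (hB : 3 ≤ p.B) : {n : ℕ} → {t : DNode K V n} →
    DNode.RootSizeReq p n t → DNode.entries n t ≠ [] → ∀ l ∈ DNode.leaves n t, l.1 ≠ []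
  | 0, ⟨es, q⟩, _, h => by
    simpa [DNode.leaves, DNode.entries] using h
  | n + 1, ⟨ks, cs⟩, h, _ => by
    simp only [DNode.leaves, List.mem_flatMap]
    rintro l ⟨c, hc, hl⟩
    exact DNode.leaves_ne_nil hB (h.2 c hc) l hl

/-! ### Replacing pointers -/

theorem DNode.leaves_mapPtr (g : List (Entry K V) → Option ℕ → Option ℕ) : (n : ℕ) →
    (t : DNode K V n) → DNode.leaves n (DNode.mapPtr g n t) =
      (DNode.leaves n t).map fun l => (l.1, g l.1 l.2)
  | 0, ⟨es, q⟩ => rfl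
  | n + 1, ⟨ks, cs⟩ => by
    simp only [DNode.leaves, DNode.mapPtr, List.flatMap_map, List.map_flatMap]
    exact List.flatMap_congr fun c _ => DNode.leaves_mapPtr g n c

theorem DNode.entries_mapPtr (g : List (Entry K V) → Option ℕ → Option ℕ) (n : ℕ)
    (t : DNode K V n) : DNode.entries n (DNode.mapPtr g n t) = DNode.entries n t := by
  simp [DNode.entries, DNode.leaves_mapPtr, List.flatMap_map]

theorem DNode.SizeReq.mapPtr {p : Params} (g : List (Entry K V) → Option ℕ → Option ℕ) :
    {n : ℕ} → {t : DNode K V n} → DNode.SizeReq p n t → DNode.SizeReq p n (DNode.mapPtr g n t)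
  | 0, ⟨_, _⟩, h => h
  | n + 1, ⟨ks, cs⟩, h => by
    refine ⟨h.1, h.2.1, fun c hc => ?_⟩
    obtain ⟨c', hc', rfl⟩ := List.mem_map.1 hc
    exact (h.2.2 c' hc').mapPtr g

theorem DNode.RootSizeReq.mapPtr {p : Params} (g : List (Entry K V) → Option ℕ → Option ℕ) :
    {n : ℕ} → {t : DNode K V n} → DNode.RootSizeReq p n t →
      DNode.RootSizeReq p n (DNode.mapPtr g n t)
  | 0, ⟨_, _⟩, h => h
  | n + 1, ⟨ks, cs⟩, h => by
    refine ⟨h.1, fun c hc => ?_⟩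
    obtain ⟨c', hc', rfl⟩ := List.mem_map.1 hc
    exact (h.2 c' hc').mapPtr g

theorem DNode.HasKey.mapPtr (g : List (Entry K V) → Option ℕ → Option ℕ) :
    {n : ℕ} → {t : DNode K V n} → DNode.HasKey n t → DNode.HasKey n (DNode.mapPtr g n t)
  | 0, _, _ => trivial
  | _ + 1, ⟨_, _⟩, h => h

section order

variable [LinearOrder K]

theorem DNode.isBPlus_succ {n : ℕ} {ks : List K} {cs : List (DNode K V n)} :
    DNode.IsBPlus (n + 1) ⟨ks, cs⟩ ↔ cs.length = ks.length + 1 ∧ Sep (DNode.entries n) ks cs ∧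
      ∀ c ∈ cs, DNode.IsBPlus n c := by
  rw [DNode.IsBPlus]
  constructor
  · rintro ⟨h1, h2, h3, h4, h5⟩
    exact ⟨h2, (sep_iff_getElem? h2).2 ⟨h1, h3, h4⟩, h5⟩
  · rintro ⟨h2, h, h5⟩
    obtain ⟨h1, h3, h4⟩ := (sep_iff_getElem? h2).1 h
    exact ⟨h1, h2, h3, h4, h5⟩

theorem DTree.isBPlus_iff (d : DTree K V) :
    d.IsBPlus ↔ DNode.HasKey d.height d.root ∧ DNode.IsBPlus d.height d.root := by
  obtain ⟨_ | n, t⟩ := d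
  · simp [DTree.IsBPlus, DNode.HasKey]
  · rfl

theorem DNode.entries_ne_nil {p : Params} (hB : 3 ≤ p.B) : {n : ℕ} → {t : DNode K V n} →
    DNode.SizeReq p n t → DNode.IsBPlus n t → DNode.entries n t ≠ []
  | 0, ⟨es, q⟩, h, _ => by
    rw [DNode.entries_zero]
    rintro rfl
    have := h.1
    simp at this; omega
  | n + 1, ⟨ks, cs⟩, h, hb => by
    obtain ⟨h1, -, h2⟩ := DNode.isBPlus_succ.1 hb
    cases cs with
    | nil => simp at h1
    | cons c cs =>
      have := DNode.entries_ne_nil hB (h.2.2 c (by simp)) (h2 c (by simp))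
      simp [DNode.entries_succ, this]

theorem DNode.IsBPlus.ascending : {n : ℕ} → {t : DNode K V n} → DNode.IsBPlus n t →
    Ascending (DNode.entries n t)
  | 0, ⟨es, q⟩, h => by
    rw [DNode.entries_zero]
    exact (ascending_iff es).2 h
  | n + 1, ⟨ks, cs⟩, h => by
    obtain ⟨h1, h2, h3⟩ := DNode.isBPlus_succ.1 h
    have h3' := fun c hc => DNode.IsBPlus.ascending (h3 c hc)
    rw [DNode.entries_succ]
    clear h h3
    induction ks generalizing cs with
    | nil =>
      obtain ⟨c, rfl⟩ := List.length_eq_one_iff.1 h1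
      simpa using h3' c
    | cons k ks ih =>
      cases cs with
      | nil => exact h2.elim
      | cons c cs =>
        rw [List.flatMap_cons, Ascending, List.pairwise_append]
        refine ⟨h3' c (by simp), ih cs (by simpa using h1) h2.2.2.2
          fun c hc => h3' c (by simp [hc]), fun a ha b hb => ?_⟩
        obtain ⟨c', hc', hb⟩ := List.mem_flatMap.1 hb
        exact (h2.1 a ha).trans_lt (h2.2.2.1 c' hc' b hb)

/-! ### Insertion below a d-node -/

/-- The sequences of leaf d-nodes before and after an insertion: one leaf d-node receives the entry,
and it may be cut into two. -/
inductive LeavesStep (e : Entry K V) :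
    List (List (Entry K V) × Option ℕ) → List (List (Entry K V) × Option ℕ) → Prop
  | one (A B : List (List (Entry K V) × Option ℕ)) (es : List (Entry K V)) (q : Option ℕ)
      (hA : ∀ x ∈ A.flatMap Prod.fst, x.key < e.key)
      (hB : ∀ x ∈ B.flatMap Prod.fst, e.key < x.key) :
      LeavesStep e (A ++ (es, q) :: B) (A ++ (insertSorted e es, q) :: B)
  | two (A B : List (List (Entry K V) × Option ℕ)) (es lo hi : List (Entry K V)) (q : Option ℕ)
      (hA : ∀ x ∈ A.flatMap Prod.fst, x.key < e.key)
      (hB : ∀ x ∈ B.flatMap Prod.fst, e.key < x.key)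
      (h : lo ++ hi = insertSorted e es) :
      LeavesStep e (A ++ (es, q) :: B) (A ++ (lo, nextPtr hi q) :: (hi, q) :: B)

theorem insertSorted_append₃ {e : Entry K V} {as es bs : List (Entry K V)}
    (ha : ∀ x ∈ as, x.key < e.key) (hb : ∀ x ∈ bs, e.key < x.key) :
    insertSorted e (as ++ (es ++ bs)) = as ++ (insertSorted e es ++ bs) := by
  induction as with
  | nil =>
    induction es with
    | nil =>
      have := insertSorted_append (as := []) (by simp) hb
      simpa [insertSorted] using this
    | cons a es ih =>
      simp only [List.nil_append, List.cons_append, insertSorted] at ih ⊢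
      split
      · rfl
      · rw [ih, List.cons_append]
  | cons a as ih =>
    have := ha a (by simp)
    rw [List.cons_append, insertSorted, if_neg (not_lt.2 this.le), ih fun x hx => ha x (by simp [hx])]
    rfl

theorem LeavesStep.entries {e : Entry K V} {ls ls' : List (List (Entry K V) × Option ℕ)}
    (h : LeavesStep e ls ls') :
    ls'.flatMap Prod.fst = insertSorted e (ls.flatMap Prod.fst) := by
  cases h with
  | one A B es q hA hB =>
    simp only [List.flatMap_append, List.flatMap_cons]
    rw [insertSorted_append₃ hA hB]
  | two A B es lo hi q hA hB h =>
    simp only [List.flatMap_append, List.flatMap_cons]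
    rw [insertSorted_append₃ hA hB, ← h, List.append_assoc]

theorem LeavesStep.append {e : Entry K V} {ls ls' : List (List (Entry K V) × Option ℕ)}
    (h : LeavesStep e ls ls') {A B : List (List (Entry K V) × Option ℕ)}
    (hA : ∀ x ∈ A.flatMap Prod.fst, x.key < e.key)
    (hB : ∀ x ∈ B.flatMap Prod.fst, e.key < x.key) :
    LeavesStep e (A ++ ls ++ B) (A ++ ls' ++ B) := by
  cases h with
  | one A' B' es q hA' hB' =>
    have := LeavesStep.one (e := e) (A ++ A') (B' ++ B) es q
      (by simp only [List.flatMap_append, List.mem_append]; grind)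
      (by simp only [List.flatMap_append, List.mem_append]; grind)
    simpa using this
  | two A' B' es lo hi q hA' hB' h =>
    have := LeavesStep.two (e := e) (A ++ A') (B' ++ B) es lo hi q
      (by simp only [List.flatMap_append, List.mem_append]; grind)
      (by simp only [List.flatMap_append, List.mem_append]; grind) h
    simpa using this

/-- What an insertion of `e` below the d-node `t` produces. -/
def DNode.InsertSpec (p : Params) (e : Entry K V) (n : ℕ) (t : DNode K V n) : DRes K V n → Prop
  | .one t' => DNode.RootSizeReq p n t' ∧ (DNode.SizeReq p n t → DNode.SizeReq p n t') ∧
      DNode.IsBPlus n t' ∧ (DNode.HasKey n t → DNode.HasKey n t') ∧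
      LeavesStep e (DNode.leaves n t) (DNode.leaves n t')
  | .two l k r => DNode.SizeReq p n l ∧ DNode.SizeReq p n r ∧ DNode.IsBPlus n l ∧
      DNode.IsBPlus n r ∧ (∀ x ∈ DNode.entries n l, x.key ≤ k) ∧
      (∀ x ∈ DNode.entries n r, k < x.key) ∧
      LeavesStep e (DNode.leaves n t) (DNode.leaves n l ++ DNode.leaves n r)

theorem DNode.insertSpec_zero {p : Params} (hB : 3 ≤ p.B) {e : Entry K V} {es : List (Entry K V)}
    {q : Option ℕ} (hs : es.length ≤ p.B - 1) (h : Ascending es) (he : ∀ x ∈ es, x.key ≠ e.key) :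
    DNode.InsertSpec p e 0 ⟨es, q⟩ (DNode.insert p e 0 ⟨es, q⟩) := by
  have hl := length_insertSorted e es
  have hasc := h.insertSorted he
  rw [DNode.insert]
  split_ifs with hle
  · refine ⟨hle, fun hs' => ⟨?_, hle⟩, (ascending_iff _).1 hasc, fun h => h, ?_⟩
    · have := hs'.1
      omega
    · simpa [DNode.leaves] using LeavesStep.one (e := e) [] [] es q (by simp) (by simp)
  -- An overfull leaf d-node has exactly `B ≥ 3` keys, so the lower half is nonempty and `x`, at
  -- index `length / 2 - 1`, is its last entry, the separator. The halves have `⌊B/2⌋` and `⌈B/2⌉`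
  -- keys.
  · obtain ⟨lo, x, hi, hcut, hlen⟩ := exists_append_cons (insertSorted e es)
      ((insertSorted e es).length / 2 - 1) (by omega)
    have hm : (insertSorted e es).length / 2 = (lo ++ [x]).length := by simp; omega
    have hcut' : insertSorted e es = (lo ++ [x]) ++ hi := by simpa using hcut
    have htot : (insertSorted e es).length = lo.length + 1 + hi.length := by rw [hcut']; simp; omega
    have htake : (insertSorted e es).take ((insertSorted e es).length / 2) = lo ++ [x] := by
      rw [hm, hcut', List.take_left]
    have hdrop : (insertSorted e es).drop ((insertSorted e es).length / 2) = hi := by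
      rw [hm, hcut', List.drop_left]
    simp only [htake, hdrop, List.getLast?_append, List.getLast?_singleton, Option.some_or]
    rw [hcut, Ascending, List.pairwise_append, List.pairwise_cons] at hasc
    obtain ⟨ha1, ⟨ha2, ha3⟩, ha4⟩ := hasc
    refine ⟨⟨by simp; omega, by simp; omega⟩, ⟨by omega, by omega⟩, (ascending_iff _).1 ?_,
      (ascending_iff _).1 ha3, ?_, ?_, ?_⟩
    · rw [Ascending, List.pairwise_append]
      exact ⟨ha1, by simp, fun a ha b hb => ha4 a ha b (by simp [List.mem_singleton.1 hb])⟩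
    · rw [DNode.entries_zero]
      intro y hy
      rcases List.mem_append.1 hy with hy | hy
      · exact (ha4 y hy x (by simp)).le
      · rw [List.mem_singleton.1 hy]
    · rw [DNode.entries_zero]
      exact ha2
    · simpa [DNode.leaves] using
        LeavesStep.two (e := e) [] [] es (lo ++ [x]) hi q (by simp) (by simp) hcut'.symm

/-- The key under which `e` is inserted is the only new key below the d-node. -/
theorem LeavesStep.key_mem {e : Entry K V} {ls ls' : List (List (Entry K V) × Option ℕ)}
    (h : LeavesStep e ls ls') {x : Entry K V} (hx : x ∈ ls'.flatMap Prod.fst) :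
    x.key = e.key ∨ ∃ y ∈ ls.flatMap Prod.fst, y.key = x.key := by
  rw [h.entries, mem_insertSorted] at hx
  rcases hx with rfl | hx
  · exact .inl rfl
  · exact .inr ⟨x, hx, rfl⟩

/-- Removing the middle one of exactly `B'` keys leaves `⌊B'/2⌋` and `⌊(B'-1)/2⌋` keys, both within
bounds. The d-node `t` before the insertion enters only through its leaf sequence. -/
theorem DNode.insertSpec_cut {p : Params} (hB' : 3 ≤ p.B') {e : Entry K V} {n : ℕ} {ks : List K}
    {cs : List (DNode K V n)} {t : DNode K V (n + 1)} (hlen : ks.length = p.B')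
    (hs : ∀ c ∈ cs, DNode.SizeReq p n c) (hb : DNode.IsBPlus (n + 1) ⟨ks, cs⟩)
    (hstep : LeavesStep e (DNode.leaves (n + 1) t) (DNode.leaves (n + 1) ⟨ks, cs⟩)) :
    DNode.InsertSpec p e (n + 1) t (match ks[ks.length / 2]? with
      | some x => .two ⟨ks.take (ks.length / 2), cs.take (ks.length / 2 + 1)⟩ x
          ⟨ks.drop (ks.length / 2 + 1), cs.drop (ks.length / 2 + 1)⟩
      | none => .one ⟨ks, cs⟩) := by
  obtain ⟨hcl, hsep, hkids⟩ := DNode.isBPlus_succ.1 hb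
  obtain ⟨kl, x, kr, hk, hkl⟩ := exists_append_cons ks (ks.length / 2) (by omega)
  obtain ⟨cl, c, cr, hc, hcl'⟩ := exists_append_cons cs (ks.length / 2) (by omega)
  have hkr : ks.length = kl.length + 1 + kr.length := by rw [hk]; simp; omega
  have hcr : cs.length = cl.length + 1 + cr.length := by rw [hc]; simp; omega
  rw [← hkl]
  have h1 : cs.take (kl.length + 1) = cl ++ [c] := by
    rw [show cs = (cl ++ [c]) ++ cr by simp [hc]]
    exact List.take_left' (by simp; omega)
  have h2 : cs.drop (kl.length + 1) = cr := by
    rw [show cs = (cl ++ [c]) ++ cr by simp [hc]]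
    exact List.drop_left' (by simp; omega)
  have h3 : ks.drop (kl.length + 1) = kr := by
    rw [show ks = (kl ++ [x]) ++ kr by simp [hk]]
    exact List.drop_left' (by simp)
  have h4 : ks.take kl.length = kl := by rw [hk, List.take_left]
  have h5 : ks[kl.length]? = some x := by simp [hk]
  rw [h5, h1, h2, h3, h4]
  have hmem : ∀ d ∈ cl ++ [c], d ∈ cs := fun d hd => List.take_subset _ _ (h1 ▸ hd)
  rw [hk, hc] at hsep
  obtain ⟨s1, s2, s3, s4⟩ := hsep.split (by omega)
  refine ⟨⟨by omega, by omega, fun d hd => hs d (hmem d hd)⟩,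
    ⟨by omega, by omega, fun d hd => hs d (by simp [hc, hd])⟩,
    DNode.isBPlus_succ.2 ⟨by simp; omega, s1, fun d hd => hkids d (hmem d hd)⟩,
    DNode.isBPlus_succ.2 ⟨by omega, s2, fun d hd => hkids d (by simp [hc, hd])⟩, ?_, ?_, ?_⟩
  · intro y hy
    obtain ⟨d, hd, hy⟩ := DNode.mem_entries_succ.1 hy
    exact s3 d hd y hy
  · intro y hy
    obtain ⟨d, hd, hy⟩ := DNode.mem_entries_succ.1 hy
    exact s4 d hd y hy
  · rw [hc] at hstep
    simpa [DNode.leaves] using hstep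

/-- Induction on the height. The separators put all leaf d-nodes left of the chosen child below `e`
and all those right of it above `e`, so the change in the child's leaf sequence is one in the whole
sequence. Only the root size bound is assumed, because the same statement serves the root and inner
d-nodes. -/
theorem DNode.insertSpec {p : Params} (hB : 3 ≤ p.B) (hB' : 3 ≤ p.B') (e : Entry K V) :
    (n : ℕ) → (t : DNode K V n) → DNode.RootSizeReq p n t → DNode.IsBPlus n t →
    (∀ x ∈ DNode.entries n t, x.key ≠ e.key) → DNode.InsertSpec p e n t (DNode.insert p e n t)
  | 0, ⟨es, q⟩, hs, hb, he => DNode.insertSpec_zero hB hs ((ascending_iff es).2 hb)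
      (by rwa [DNode.entries_zero] at he)
  | n + 1, ⟨ks, cs⟩, hs, hb, he => by
    obtain ⟨hlen, hsep, hkids⟩ := DNode.isBPlus_succ.1 hb
    obtain ⟨kl, kr, rfl, htw, hkl, hkr⟩ := takeWhile_lt_append hsep.pairwise e.key
    obtain ⟨cl, c, cr, rfl, hcl⟩ := exists_append_cons cs kl.length (by simp at hlen; omega)
    have hl : kl.length = cl.length := hcl.symm
    have hr : kr.length = cr.length := by simp at hlen; omega
    have hA : ∀ x ∈ (cl.flatMap (DNode.leaves n)).flatMap Prod.fst, x.key < e.key := by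
      intro x hx
      rw [List.flatMap_assoc] at hx
      obtain ⟨c', hc', hx⟩ := List.mem_flatMap.1 hx
      exact hsep.lt_of_mem_left hl hkl hc' hx
    have hBr : ∀ x ∈ (cr.flatMap (DNode.leaves n)).flatMap Prod.fst, e.key < x.key := by
      intro x hx
      rw [List.flatMap_assoc] at hx
      obtain ⟨c', hc', hx⟩ := List.mem_flatMap.1 hx
      exact hsep.lt_of_mem_right hl hr hkr hc' hx
    have ih := DNode.insertSpec hB hB' e n c (hs.2 c (by simp)).rootSizeReq (hkids c (by simp))
      fun x hx => he x (DNode.mem_entries_succ.2 ⟨c, by simp, hx⟩)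
    rw [DNode.insert, htw]
    simp only [hl, List.getElem?_append_right, le_refl, Nat.sub_self, List.getElem?_cons_zero]
    cases hres : DNode.insert p e n c with
    | one c₁ =>
      rw [hres] at ih
      obtain ⟨-, i1, i2, -, i3⟩ := ih
      simp only [List.set_append_right, le_refl, Nat.sub_self, List.set_cons_zero]
      have hs' : ∀ d ∈ cl ++ c₁ :: cr, DNode.SizeReq p n d := by
        intro d hd
        simp only [List.mem_append, List.mem_cons] at hd
        rcases hd with hd | rfl | hd
        · exact hs.2 d (by simp [hd])
        · exact i1 (hs.2 c (by simp))
        · exact hs.2 d (by simp [hd])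
      refine ⟨⟨hs.1, hs'⟩, fun h => ⟨h.1, h.2.1, hs'⟩, DNode.isBPlus_succ.2 ⟨by simpa using hlen,
        hsep.replace hl hkl hkr fun x hx => i3.key_mem hx, ?_⟩, fun h => h, ?_⟩
      · intro d hd
        simp only [List.mem_append, List.mem_cons] at hd
        rcases hd with hd | rfl | hd
        · exact hkids d (by simp [hd])
        · exact i2
        · exact hkids d (by simp [hd])
      · simpa [DNode.leaves] using i3.append hA hBr
    | two l k r =>
      rw [hres] at ih
      obtain ⟨i1, i2, i3, i4, i5, i6, i7⟩ := ih
      have hks : (kl ++ kr).take cl.length ++ k :: (kl ++ kr).drop cl.length = kl ++ k :: kr := by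
        rw [← hl, List.take_left, List.drop_left]
      have hcs : (cl ++ c :: cr).take cl.length ++ l :: r :: (cl ++ c :: cr).drop (cl.length + 1) =
          cl ++ l :: r :: cr := by
        rw [List.take_left, show cl ++ c :: cr = (cl ++ [c]) ++ cr by simp,
          List.drop_left' (by simp)]
      simp only [hks, hcs]
      have hsep' := (hsep.replace_two (l := l) (r := r) (k := k) hl hr hkl hkr
        (fun x hx => i7.key_mem (by simpa using .inl (by simpa [DNode.entries] using hx)))
        (fun x hx => i7.key_mem (by simpa using .inr (by simpa [DNode.entries] using hx)))
        i5 i6 (DNode.entries_ne_nil hB i1 i3) (DNode.entries_ne_nil hB i2 i4)).1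
      have hs' : ∀ d ∈ cl ++ l :: r :: cr, DNode.SizeReq p n d := by
        intro d hd
        simp only [List.mem_append, List.mem_cons] at hd
        rcases hd with hd | rfl | rfl | hd
        · exact hs.2 d (by simp [hd])
        · exact i1
        · exact i2
        · exact hs.2 d (by simp [hd])
      have hb' : DNode.IsBPlus (n + 1) ⟨kl ++ k :: kr, cl ++ l :: r :: cr⟩ := by
        refine DNode.isBPlus_succ.2 ⟨by simp at hlen ⊢; omega, hsep', fun d hd => ?_⟩
        simp only [List.mem_append, List.mem_cons] at hd
        rcases hd with hd | rfl | rfl | hd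
        · exact hkids d (by simp [hd])
        · exact i3
        · exact i4
        · exact hkids d (by simp [hd])
      have hstep : LeavesStep e (DNode.leaves (n + 1) ⟨kl ++ kr, cl ++ c :: cr⟩)
          (DNode.leaves (n + 1) ⟨kl ++ k :: kr, cl ++ l :: r :: cr⟩) := by
        simpa [DNode.leaves] using i7.append hA hBr
      have hlk : (kl ++ k :: kr).length = (kl ++ kr).length + 1 := by simp; omega
      split_ifs with hle
      · exact ⟨⟨hle, hs'⟩, fun h => ⟨by rw [hlk]; exact h.1.trans (Nat.le_succ _), hle, hs'⟩, hb',
          fun _ => by simp [DNode.HasKey], hstep⟩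
      · have := hs.1
        exact DNode.insertSpec_cut hB' (by omega) hs' hb' hstep

theorem sep_map {α β : Type*} {F : α → List (Entry K V)} {G : β → List (Entry K V)} (g : β → α)
    (hg : ∀ b, F (g b) = G b) {ks : List K} {cs : List β} (h : Sep G ks cs) :
    Sep F ks (cs.map g) := by
  induction ks generalizing cs with
  | nil => trivial
  | cons k ks ih =>
    cases cs with
    | nil => exact h.elim
    | cons c cs =>
      refine ⟨by rw [hg]; exact h.1, h.2.1, fun c' hc' => ?_, ih h.2.2.2⟩
      obtain ⟨b, hb, rfl⟩ := List.mem_map.1 hc'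
      rw [hg]; exact h.2.2.1 b hb

theorem DNode.IsBPlus.mapPtr (g : List (Entry K V) → Option ℕ → Option ℕ) :
    {n : ℕ} → {t : DNode K V n} → DNode.IsBPlus n t → DNode.IsBPlus n (DNode.mapPtr g n t)
  | 0, ⟨_, _⟩, h => h
  | n + 1, ⟨ks, cs⟩, h => by
    obtain ⟨h1, h2, h3⟩ := DNode.isBPlus_succ.1 h
    refine DNode.isBPlus_succ.2 ⟨by simpa using h1, sep_map _ (DNode.entries_mapPtr g n) h2,
      fun c hc => ?_⟩
    obtain ⟨c', hc', rfl⟩ := List.mem_map.1 hc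
    exact (h3 c' hc').mapPtr g

/-! ### d-trees -/

/-- A d-tree that meets the size requirements and the B⁺-tree property, and in which the pointers
`P_{s-node}` lead to the next s-keys, or to `last`. -/
structure DTree.OK (p : Params) (last : Option ℕ) (d : DTree K V) : Prop where
  size : DNode.RootSizeReq p d.height d.root
  hasKey : DNode.HasKey d.height d.root
  bplus : DNode.IsBPlus d.height d.root
  ptr : PtrOK last d.leaves

theorem DTree.OK.ascending {p : Params} {last : Option ℕ} {d : DTree K V} (h : d.OK p last) :
    Ascending d.entries := h.bplus.ascending

theorem DNode.leaves_nonempty : {n : ℕ} → {t : DNode K V n} → DNode.IsBPlus n t →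
    DNode.leaves n t ≠ []
  | 0, ⟨_, _⟩, _ => by simp [DNode.leaves]
  | n + 1, ⟨ks, cs⟩, h => by
    obtain ⟨h1, -, h3⟩ := DNode.isBPlus_succ.1 h
    cases cs with
    | nil => simp at h1
    | cons c cs =>
      have := DNode.leaves_nonempty (h3 c (by simp))
      simp [DNode.leaves, this]

/-- No s-key follows the last leaf d-node, so its pointer has to be the default. This justifies the
fallback in `DTree.route`. -/
theorem DTree.OK.lastPtr_eq {p : Params} {last : Option ℕ} {d : DTree K V} (h : d.OK p last) :
    d.lastPtr = last := by
  have hne : d.leaves ≠ [] := DNode.leaves_nonempty h.bplus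
  have hp := h.ptr
  obtain ⟨ls, l, hl⟩ := (List.eq_nil_or_concat d.leaves).resolve_left hne
  rw [DTree.lastPtr]
  rw [hl] at hp ⊢
  simp only [List.concat_eq_append, ptrOK_append] at hp
  simpa [PtrOK] using hp.2

theorem DTree.insert_spec {p : Params} (hB : 3 ≤ p.B) (hB' : 3 ≤ p.B') {e : Entry K V}
    {d : DTree K V} (hs : DNode.RootSizeReq p d.height d.root)
    (hk : DNode.HasKey d.height d.root) (hb : DNode.IsBPlus d.height d.root)
    (he : ∀ x ∈ d.entries, x.key ≠ e.key) :
    DNode.RootSizeReq p (d.insert p e).height (d.insert p e).root ∧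
    DNode.HasKey (d.insert p e).height (d.insert p e).root ∧
    DNode.IsBPlus (d.insert p e).height (d.insert p e).root ∧
    LeavesStep e d.leaves (d.insert p e).leaves := by
  have h := DNode.insertSpec hB hB' e d.height d.root hs hb he
  unfold DTree.insert
  cases hres : DNode.insert p e d.height d.root with
  | one t =>
    rw [hres] at h
    exact ⟨h.1, h.2.2.2.1 hk, h.2.2.1, h.2.2.2.2⟩
  | two l k r =>
    rw [hres] at h
    obtain ⟨h1, h2, h3, h4, h5, h6, h7⟩ := h
    refine ⟨⟨?_, ?_⟩, by simp [DNode.HasKey], DNode.isBPlus_succ.2 ⟨rfl, ?_, ?_⟩, ?_⟩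
    · simp; omega
    · simp [h1, h2]
    · simpa [Sep] using ⟨h5, h6⟩
    · simp [h3, h4]
    · simpa [DTree.leaves, DNode.leaves] using h7

theorem DTree.entries_insert {p : Params} (hB : 3 ≤ p.B) (hB' : 3 ≤ p.B') {last : Option ℕ}
    {e : Entry K V} {d : DTree K V} (h : d.OK p last) (he : ∀ x ∈ d.entries, x.key ≠ e.key) :
    (d.insert p e).entries = insertSorted e d.entries :=
  (DTree.insert_spec hB hB' h.size h.hasKey h.bplus he).2.2.2.entries

/-- An entry without pointer is invisible to `nextPtr`. When a leaf d-node is cut, the rule for the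
lower half is literally the required condition. -/
theorem LeavesStep.ptrOK {e : Entry K V} (he : e.ptr = none) {last : Option ℕ}
    {ls ls' : List (List (Entry K V) × Option ℕ)} (hs : LeavesStep e ls ls')
    (h : PtrOK last ls) : PtrOK last ls' := by
  cases hs with
  | one A B es q hA hB =>
    simpa [ptrOK_append, PtrOK, nextPtr_insertSorted he] using h
  | two A B es lo hi q hA hB hc =>
    have := fun q => nextPtr_insertSorted he es q
    simp only [← hc, nextPtr_append] at this
    simp only [ptrOK_append, PtrOK, List.flatMap_cons, nextPtr_append, this] at h ⊢
    exact ⟨h.1, by rw [h.2.1], h.2⟩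

theorem DTree.OK.insert {p : Params} (hB : 3 ≤ p.B) (hB' : 3 ≤ p.B') {last : Option ℕ}
    {e : Entry K V} (hp : e.ptr = none) {d : DTree K V} (h : d.OK p last)
    (he : ∀ x ∈ d.entries, x.key ≠ e.key) : (d.insert p e).OK p last := by
  obtain ⟨h1, h2, h3, h4⟩ := DTree.insert_spec hB hB' h.size h.hasKey h.bplus he
  exact ⟨h1, h2, h3, h4.ptrOK hp h.ptr⟩

end order

theorem nextPtr_filter {es : List (Entry K V)} {P : Entry K V → Bool}
    (h : ∀ x ∈ es, x.ptr.isSome → P x) (q : Option ℕ) :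
    nextPtr (es.filter P) q = nextPtr es q := by
  induction es with
  | nil => rfl
  | cons x es ih =>
    have ih' := ih fun y hy => h y (by simp [hy])
    by_cases hx : P x
    · simp [hx, ih']
    · have : x.ptr = none := by
        by_contra hn
        exact hx (h x (by simp) (Option.isSome_iff_ne_none.2 hn))
      simp [hx, ih', this]

section order

variable [LinearOrder K]

/-! ### Insertion of an s-key into a d-tree -/

/-- Every `P_{s-node}` leads to the next s-key, where the entry `e` may be disregarded. -/
def PtrNear (e : Entry K V) (last : Option ℕ) : List (List (Entry K V) × Option ℕ) → Prop
  | [] => True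
  | l :: ls => (l.2 = nextPtr (ls.flatMap Prod.fst) last ∨
      l.2 = nextPtr ((ls.flatMap Prod.fst).filter fun x => x.key ≠ e.key) last) ∧ PtrNear e last ls

theorem PtrOK.ptrNear (e : Entry K V) {last : Option ℕ}
    {ls : List (List (Entry K V) × Option ℕ)} (h : PtrOK last ls) : PtrNear e last ls := by
  induction ls with
  | nil => trivial
  | cons l ls ih => exact ⟨.inl h.1, ih h.2⟩

/-- Leaf d-nodes left of the insertion are unchanged, so their pointers are right for the sequence
without `e`: the second alternative of `PtrNear`. -/
theorem PtrNear.prepend {e : Entry K V} {last : Option ℕ}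
    {A ls ls' : List (List (Entry K V) × Option ℕ)}
    (hfilter : (ls'.flatMap Prod.fst).filter (fun x => x.key ≠ e.key) = ls.flatMap Prod.fst)
    (hA : ∀ x ∈ A.flatMap Prod.fst, x.key < e.key)
    (h : PtrOK last (A ++ ls)) (h' : PtrNear e last ls') : PtrNear e last (A ++ ls') := by
  induction A with
  | nil => exact h'
  | cons a A ih =>
    simp only [List.flatMap_cons, List.mem_append] at hA
    refine ⟨.inr ?_, ih (fun x hx => hA x (.inr hx)) h.2⟩
    change a.2 = nextPtr (((A ++ ls').flatMap Prod.fst).filter fun x => x.key ≠ e.key) last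
    rw [List.flatMap_append, List.filter_append, hfilter,
      List.filter_eq_self.2 (by simpa using fun x hx => (hA x (.inr hx)).ne)]
    simpa using h.1

theorem filter_insertSorted_append {e : Entry K V} {es B : List (Entry K V)}
    (h : ∀ x ∈ es, x.key ≠ e.key) (hB : ∀ x ∈ B, x.key ≠ e.key) :
    (insertSorted e es ++ B).filter (fun x => x.key ≠ e.key) = es ++ B := by
  have hB' : B.filter (fun x => x.key ≠ e.key) = B := List.filter_eq_self.2 (by simpa using hB)
  rw [List.filter_append, hB']
  congr 1
  induction es with
  | nil => simp [insertSorted]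
  | cons a es ih =>
    rw [List.forall_mem_cons] at h
    have hes : es.filter (fun x => x.key ≠ e.key) = es := List.filter_eq_self.2 (by simpa using h.2)
    rw [insertSorted]
    split
    · rw [List.filter_cons_of_neg (by simp), List.filter_cons_of_pos (by simpa using h.1), hes]
    · rw [List.filter_cons_of_pos (by simpa using h.1), ih h.2]

/-- To the left of the insertion the pointers disregard `e`. The leaf d-node that receives `e`, or
its two halves, and everything to the right satisfy the first alternative. -/
theorem LeavesStep.ptrNear {e : Entry K V} {last : Option ℕ}
    {ls ls' : List (List (Entry K V) × Option ℕ)} (hs : LeavesStep e ls ls')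
    (he : ∀ x ∈ ls.flatMap Prod.fst, x.key ≠ e.key) (h : PtrOK last ls) :
    PtrNear e last ls' := by
  cases hs with
  | one A B es q hA hB =>
    have h2 := ((ptrOK_append _ _ _).1 h).2
    simp only [List.flatMap_append, List.flatMap_cons, List.mem_append] at he
    refine PtrNear.prepend (ls := (es, q) :: B) ?_ hA h ⟨.inl h2.1, h2.2.ptrNear e⟩
    simp only [List.flatMap_cons]
    exact filter_insertSorted_append (fun x hx => he x (.inr (.inl hx))) fun x hx => (hB x hx).ne'
  | two A B es lo hi q hA hB hc =>
    have h2 := ((ptrOK_append _ _ _).1 h).2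
    simp only [List.flatMap_append, List.flatMap_cons, List.mem_append] at he
    refine PtrNear.prepend (ls := (es, q) :: B) ?_ hA h ⟨.inl ?_, .inl h2.1, h2.2.ptrNear e⟩
    · simp only [List.flatMap_cons, ← List.append_assoc, hc]
      exact filter_insertSorted_append (fun x hx => he x (.inr (.inl hx))) fun x hx => (hB x hx).ne'
    · have h3 : q = nextPtr (B.flatMap Prod.fst) last := h2.1
      simp [h3]

/-- The pointer that an insertion of the s-key `e` gives to a leaf d-node; `kS` and `kL` are the
adjacent s-keys. -/
def newPtr (e : Entry K V) (hiPtr : Option ℕ) (kS kL : Option K) (es : List (Entry K V))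
    (q : Option ℕ) : Option ℕ :=
  match es.getLast? with
  | none => q
  | some x =>
    if x.key < e.key then
      match kS with
      | none => e.ptr
      | some k => if k ≤ x.key then e.ptr else q
    else
      match kL with
      | none => hiPtr
      | some k => if x.key < k then hiPtr else q

/-- Let `x` be the largest key of a leaf d-node. If `x < e` and no s-key lies between them, the next
s-key is now `e`; if one lies between, the old pointer leads to it and stays. If `x ≥ e`, the next
s-key after `x` is the first one after `e` unless `x` has reached `kL`, and from there on `e` plays
no role. The default may change from `last` to `last'` only if no s-key follows `e`. The list `Q`
collects the entries already passed in the induction. -/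
theorem ptrOK_map_newPtr {e : Entry K V} (hp : e.ptr.isSome) {hiPtr last last' : Option ℕ}
    {kS kL : Option K} {P S : List (Entry K V)} (hP : ∀ x ∈ P, x.key < e.key)
    (hS : ∀ x ∈ S, e.key < x.key)
    (hkS : ∀ k, kS = some k → (∃ x ∈ P, x.ptr.isSome ∧ x.key = k) ∧
      ∀ x ∈ P, x.ptr.isSome → x.key ≤ k)
    (hkS' : kS = none → ∀ x ∈ P, x.ptr = none)
    (hkL : ∀ k, kL = some k → (∃ x ∈ S, x.ptr.isSome ∧ x.key = k) ∧
      ∀ x ∈ S, x.ptr.isSome → k ≤ x.key)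
    (hkL' : kL = none → ∀ x ∈ S, x.ptr = none)
    (hhi : hiPtr = nextPtr S last') (hlast : last' = last ∨ ∀ x ∈ S, x.ptr = none)
    (hasc : Ascending (P ++ e :: S)) (Q : List (Entry K V))
    (ls : List (List (Entry K V) × Option ℕ)) (hQ : Q ++ ls.flatMap Prod.fst = P ++ e :: S)
    (hne : ∀ l ∈ ls, l.1 ≠ []) (h : PtrNear e last ls) :
    PtrOK last' (ls.map fun l => (l.1, newPtr e hiPtr kS kL l.1 l.2)) := by
  induction ls generalizing Q with
  | nil => trivial
  | cons l ls ih =>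
    obtain ⟨es, q⟩ := l
    refine ⟨?_, ih (Q ++ es) (by simpa using hQ) (fun l hl => hne l (by simp [hl])) h.2⟩
    obtain ⟨es₀, x, hes⟩ := (List.eq_nil_or_concat es).resolve_left (hne (es, q) (by simp))
    rw [List.concat_eq_append] at hes
    subst hes
    -- By ascending order, what follows this leaf d-node is exactly what exceeds its largest key
    -- `x`, so the whole condition can be expressed through `x`.
    have hF : ls.flatMap Prod.fst = (P ++ e :: S).filter fun y => x.key < y.key := by
      have : P ++ e :: S = (Q ++ es₀) ++ x :: ls.flatMap Prod.fst := by simpa using hQ.symm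
      rw [this] at hasc ⊢
      exact (filter_lt_of_ascending hasc).2.symm
    have hq := h.1
    have hmap : (ls.map fun l => (l.1, newPtr e hiPtr kS kL l.1 l.2)).flatMap Prod.fst =
        ls.flatMap Prod.fst := by simp [List.flatMap_map]
    simp only [hmap, hF] at hq ⊢
    simp only [newPtr, List.getLast?_append, List.getLast?_singleton, Option.some_or]
    by_cases hx : x.key < e.key
    · have hS' : S.filter (fun y => decide (x.key < y.key)) = S :=
        List.filter_eq_self.2 (by simpa using fun y hy => hx.trans (hS y hy))
      have hFe : (P ++ e :: S).filter (fun y => decide (x.key < y.key)) =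
          P.filter (fun y => decide (x.key < y.key)) ++ e :: S := by
        rw [List.filter_append, List.filter_cons_of_pos (by simpa using hx), hS']
      have key : (∀ y ∈ P, y.ptr.isSome → y.key ≤ x.key) →
          e.ptr = nextPtr (P.filter (fun y => decide (x.key < y.key)) ++ e :: S) last' := by
        intro hy
        rw [nextPtr_append, nextPtr_of_forall_none, nextPtr_cons, Option.or_of_isSome hp]
        intro y hy'
        rw [List.mem_filter, decide_eq_true_iff] at hy'
        by_contra hn
        exact (hy y hy'.1 (Option.isSome_iff_ne_none.2 hn)).not_gt hy'.2
      rw [hFe] at hq ⊢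
      rw [if_pos hx]
      cases hk : kS with
      | none => exact key fun y hy h => by simp [hkS' hk y hy] at h
      | some k =>
        obtain ⟨⟨y, hy, hyp, hyk⟩, hmax⟩ := hkS k hk
        by_cases hkx : k ≤ x.key
        · simp only [hkx, if_true]
          exact key fun y hy h => (hmax y hy h).trans hkx
        · simp only [hkx, if_false]
          -- An s-key lies between `x` and `e`, so `nextPtr` stops before `e` and before any
          -- default; both alternatives of `PtrNear` then agree.
          have hy' : ∃ y ∈ P.filter (fun y => decide (x.key < y.key)), y.ptr.isSome :=
            ⟨y, by simpa [hy, hyk] using hkx, hyp⟩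
          rw [nextPtr_append, nextPtr_of_exists_isSome hy' _ none]
          rcases hq with hq | hq
          · rw [hq, nextPtr_append, nextPtr_of_exists_isSome hy' _ none]
          · rw [hq, List.filter_append, nextPtr_append, nextPtr_filter,
              nextPtr_of_exists_isSome hy' _ none]
            intro z hz _
            simpa using (hP z (List.mem_filter.1 hz).1).ne
    · have hxe := not_lt.1 hx
      have hFe : (P ++ e :: S).filter (fun y => decide (x.key < y.key)) =
          S.filter (fun y => decide (x.key < y.key)) := by
        rw [List.filter_append, List.filter_cons_of_neg (by simpa using hx),
          List.filter_eq_nil_iff.2 (by simpa using fun y hy => ((hP y hy).trans_le hxe).le),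
          List.nil_append]
      rw [hFe] at hq ⊢
      have hq' : q = nextPtr (S.filter (fun y => decide (x.key < y.key))) last := by
        rcases hq with hq | hq
        · exact hq
        · rwa [nextPtr_filter] at hq
          intro z hz _
          simpa using (hS z (List.mem_filter.1 hz).1).ne'
      rw [if_neg hx]
      cases hk : kL with
      | none =>
        have h0 := hkL' hk
        simp only
        rw [hhi, nextPtr_of_forall_none h0,
          nextPtr_of_forall_none fun y hy => h0 y (List.mem_filter.1 hy).1]
      | some k =>
        obtain ⟨⟨y, hy, hyp, hyk⟩, hmin⟩ := hkL k hk
        by_cases hkx : x.key < k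
        · simp only [hkx, if_true]
          rw [hhi, nextPtr_filter]
          exact fun z hz h => by simpa using hkx.trans_le (hmin z hz h)
        · simp only [hkx, if_false]
          rcases hlast with rfl | hlast
          · exact hq'
          · simp [hlast y hy] at hyp

theorem getLast?_sKeys_spec {P : List (Entry K V)} (h : Ascending P) :
    (∀ k, (sKeys P).getLast?.map Entry.key = some k → (∃ x ∈ P, x.ptr.isSome ∧ x.key = k) ∧
      ∀ x ∈ P, x.ptr.isSome → x.key ≤ k) ∧
    ((sKeys P).getLast?.map Entry.key = none → ∀ x ∈ P, x.ptr = none) := by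
  have hs : Ascending (sKeys P) := List.Pairwise.filter _ h
  have hm : ∀ x, x ∈ sKeys P ↔ x ∈ P ∧ x.ptr.isSome := fun x => by simp [sKeys]
  rcases List.eq_nil_or_concat (sKeys P) with h0 | ⟨as, a, h0⟩
  · rw [h0] at hm ⊢
    refine ⟨by simp, fun _ x hx => ?_⟩
    simpa [hx] using hm x
  · rw [List.concat_eq_append] at h0
    rw [h0] at hm hs ⊢
    refine ⟨?_, by simp⟩
    simp only [List.getLast?_append, List.getLast?_singleton, Option.some_or, Option.map_some,
      Option.some.injEq, forall_eq']
    refine ⟨⟨a, ((hm a).1 (by simp)).1, ((hm a).1 (by simp)).2, rfl⟩, fun x hx hxp => ?_⟩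
    rcases List.mem_append.1 ((hm x).2 ⟨hx, hxp⟩) with h1 | h1
    · exact ((List.pairwise_append.1 hs).2.2 x h1 a (by simp)).le
    · rw [List.mem_singleton.1 h1]

theorem head?_sKeys_spec {S : List (Entry K V)} (h : Ascending S) :
    (∀ k, (sKeys S).head?.map Entry.key = some k → (∃ x ∈ S, x.ptr.isSome ∧ x.key = k) ∧
      ∀ x ∈ S, x.ptr.isSome → k ≤ x.key) ∧
    ((sKeys S).head?.map Entry.key = none → ∀ x ∈ S, x.ptr = none) := by
  have hs : Ascending (sKeys S) := List.Pairwise.filter _ h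
  have hm : ∀ x, x ∈ sKeys S ↔ x ∈ S ∧ x.ptr.isSome := fun x => by simp [sKeys]
  cases h0 : sKeys S with
  | nil =>
    rw [h0] at hm
    refine ⟨by simp, fun _ x hx => ?_⟩
    simpa [hx] using hm x
  | cons a as =>
    rw [h0] at hm hs
    refine ⟨?_, by simp⟩
    simp only [List.head?_cons, Option.map_some, Option.some.injEq, forall_eq']
    refine ⟨⟨a, ((hm a).1 (by simp)).1, ((hm a).1 (by simp)).2, rfl⟩, fun x hx hxp => ?_⟩
    rcases List.mem_cons.1 ((hm x).2 ⟨hx, hxp⟩) with h1 | h1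
    · rw [h1]
    · exact ((List.pairwise_cons.1 hs).1 x h1).le

/-- The hypothesis on `hiPtr` says that it is the correct pointer just after `e`. A change of
default is needed when a d-tree is built in ascending order and when a new root s-node gets its
first s-key. -/
theorem DTree.OK.insertS {p : Params} (hB : 3 ≤ p.B) (hB' : 3 ≤ p.B') {last last' : Option ℕ}
    {e : Entry K V} (hp : e.ptr.isSome) {d : DTree K V} (h : d.OK p last)
    (he : ∀ x ∈ d.entries, x.key ≠ e.key) {hiPtr : Option ℕ}
    (hhi : hiPtr = nextPtr (d.entries.filter fun x => e.key < x.key) last')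
    (hlast : last' = last ∨ ∀ x ∈ d.entries, e.key < x.key → x.ptr = none) :
    (d.insertS p e hiPtr).OK p last' ∧
      (d.insertS p e hiPtr).entries = insertSorted e d.entries := by
  obtain ⟨h1, h2, h3, h4⟩ := DTree.insert_spec hB hB' h.size h.hasKey h.bplus he
  have hent : (d.insert p e).entries = insertSorted e d.entries := h4.entries
  obtain ⟨P, S, hPS, hP, hS⟩ := h.ascending.exists_cut he
  have hasc := h.ascending.insertSorted he
  have hsplit : Ascending P ∧ Ascending S := by
    have := h.ascending
    rw [hPS, Ascending, List.pairwise_append] at this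
    exact ⟨this.1, this.2.1⟩
  have hfl : (d.entries.filter fun x => x.key < e.key) = P := by
    rw [hPS, List.filter_append, List.filter_eq_self.2 (by simpa using hP),
      List.filter_eq_nil_iff.2 (by simpa using fun x hx => (hS x hx).le), List.append_nil]
  have hfr : (d.entries.filter fun x => e.key < x.key) = S := by
    rw [hPS, List.filter_append, List.filter_eq_nil_iff.2 (by simpa using fun x hx => (hP x hx).le),
      List.filter_eq_self.2 (by simpa using hS), List.nil_append]
  have hkS : (sKeys d.entries).filter (fun x => x.key < e.key) = sKeys P := by
    rw [← hfl, sKeys, sKeys, List.filter_filter, List.filter_filter]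
    simp only [Bool.and_comm]
  have hkL : (sKeys d.entries).filter (fun x => e.key < x.key) = sKeys S := by
    rw [← hfr, sKeys, sKeys, List.filter_filter, List.filter_filter]
    simp only [Bool.and_comm]
  have hins : insertSorted e d.entries = P ++ e :: S := by rw [hPS, insertSorted_append hP hS]
  have key : d.insertS p e hiPtr = ⟨(d.insert p e).height,
      DNode.mapPtr (newPtr e hiPtr ((sKeys P).getLast?.map Entry.key)
        ((sKeys S).head?.map Entry.key)) (d.insert p e).height (d.insert p e).root⟩ := by
    rw [← hkS, ← hkL]
    rfl
  rw [key]
  refine ⟨⟨h1.mapPtr _, h2.mapPtr _, h3.mapPtr _, ?_⟩, ?_⟩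
  · rw [DTree.leaves, DNode.leaves_mapPtr]
    refine ptrOK_map_newPtr (last := last) hp hP hS (getLast?_sKeys_spec hsplit.1).1
      (getLast?_sKeys_spec hsplit.1).2 (head?_sKeys_spec hsplit.2).1
      (head?_sKeys_spec hsplit.2).2 (by rw [hhi, hfr]) ?_ (hins ▸ hasc) []
      _ ?_ (h1.leaves_ne_nil hB ?_) (h4.ptrNear he h.ptr)
    · refine hlast.imp_right fun h x hx => h x ?_ (hS x hx)
      rw [hPS]; exact List.mem_append_right _ hx
    · rw [← hins, ← hent]; rfl
    · change (d.insert p e).entries ≠ []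
      rw [hent, hins]; simp
  · rw [DTree.entries, DNode.entries_mapPtr, ← hent]; rfl

/-! ### Building a d-tree -/

/-- Ascending order means that each entry is appended on the right. The default of the unfinished
d-tree is the pointer of the first pending s-key; inserting that s-key moves the default on to the
following one. -/
theorem DTree.insertAll_spec {p : Params} (hB : 3 ≤ p.B) (hB' : 3 ≤ p.B') {last : Option ℕ}
    {es : List (Entry K V)} {d : DTree K V} (h : d.OK p (nextPtr es last))
    (hasc : Ascending (d.entries ++ es)) :
    (DTree.insertAll p last es d).OK p last ∧
      (DTree.insertAll p last es d).entries = d.entries ++ es := by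
  induction es generalizing d with
  | nil => exact ⟨h, by simp [DTree.insertAll]⟩
  | cons e es ih =>
    have hlt : ∀ x ∈ d.entries, x.key < e.key :=
      fun x hx => (List.pairwise_append.1 hasc).2.2 x hx e (by simp)
    have hins : insertSorted e d.entries = d.entries ++ [e] := by
      simpa using insertSorted_append (bs := []) hlt (by simp)
    rw [DTree.insertAll]
    cases hp : e.ptr with
    | none =>
      rw [nextPtr_cons, hp, Option.none_or] at h
      have h' := DTree.entries_insert hB hB' h fun x hx => (hlt x hx).ne
      have := ih (h.insert hB hB' hp fun x hx => (hlt x hx).ne)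
        (by rw [h', hins]; simpa using hasc)
      rw [h', hins] at this
      simpa using this
    | some a =>
      obtain ⟨h1, h2⟩ := h.insertS hB hB' (e := e) (by simp [hp]) (fun x hx => (hlt x hx).ne)
        (hiPtr := nextPtr es last) (last' := nextPtr es last)
        (by rw [List.filter_eq_nil_iff.2 (by simpa using fun x hx => (hlt x hx).le)]; rfl)
        (.inr fun x hx hx' => absurd hx' (hlt x hx).not_gt)
      have := ih h1 (by rw [h2, hins]; simpa using hasc)
      rw [h2, hins] at this
      simpa using this

theorem DTree.OK.empty (p : Params) (q : Option ℕ) : (DTree.empty q : DTree K V).OK p q :=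
  ⟨by simp [DTree.empty, DNode.RootSizeReq], trivial, .nil, rfl, trivial⟩

theorem DTree.build_spec {p : Params} (hB : 3 ≤ p.B) (hB' : 3 ≤ p.B') (last : Option ℕ)
    {es : List (Entry K V)} (h : Ascending es) :
    (DTree.build p last es).OK p last ∧ (DTree.build p last es).entries = es :=
  DTree.insertAll_spec hB hB' (DTree.OK.empty p _) h

end order

/-- Absence of pointers in a leaf s-node is the case of default `none`, so leaf and non-leaf s-nodes
can share `DTree.OK`. -/
theorem ptrOK_none_iff {ls : List (List (Entry K V) × Option ℕ)}
    (h : ∀ e ∈ ls.flatMap Prod.fst, e.ptr = none) : PtrOK none ls ↔ ∀ l ∈ ls, l.2 = none := by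
  induction ls with
  | nil => simp [PtrOK]
  | cons l ls ih =>
    simp only [List.flatMap_cons, List.mem_append] at h
    rw [PtrOK, ih fun e he => h e (.inr he), nextPtr_of_forall_none fun e he => h e (.inr he)]
    simp

theorem length_sKeys_le (es : List (Entry K V)) : (sKeys es).length ≤ es.length :=
  List.length_filter_le _ _

section order

variable [LinearOrder K]

/-! ### The child on the search path -/

variable {α : Type w}

/-- The child for the key `y`, where the `i`-th child is responsible for the keys up to the `i`-th
separating key. -/
def childFor : List K → List α → K → Option α
  | _, [], _ => none
  | [], c :: _, _ => some c
  | k :: ks, c :: cs, y => if y < k then some c else childFor ks cs y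

theorem childFor_append {kl kr : List K} {cl cr : List α} (h : kl.length = cl.length) (y : K) :
    childFor (kl ++ kr) (cl ++ cr) y =
      if ∀ k ∈ kl, k ≤ y then childFor kr cr y else childFor kl cl y := by
  induction kl generalizing cl with
  | nil =>
    obtain rfl : cl = [] := List.length_eq_zero_iff.1 h.symm
    simp
  | cons k kl ih =>
    cases cl with
    | nil => simp at h
    | cons c cl =>
      simp only [List.cons_append, childFor, ih (cl := cl) (by simpa using h), List.forall_mem_cons]
      by_cases hk : y < k
      · simp [hk, not_le.2 hk]
      · simp [hk, not_lt.1 hk]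

/-- Strictness on the right is essential: at a separator `childFor` goes right, while `Sep` allows
that key on the left. Keys being routed are never s-keys of the node. -/
theorem childFor_eq_some {kl kr : List K} {cl cr : List α} {c : α} (h : kl.length = cl.length)
    {y : K} (hkl : ∀ k ∈ kl, k < y) (hkr : ∀ k ∈ kr, y < k) :
    childFor (kl ++ kr) (cl ++ c :: cr) y = some c := by
  rw [childFor_append h, if_pos fun k hk => (hkl k hk).le]
  cases kr with
  | nil => rfl
  | cons k kr => simp [childFor, hkr k (by simp)]

/-- This and the next three lemmas trace a child selected after a change back to the child selected
before it, which is how `PathClean` survives replacements and splits. -/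
theorem childFor_replace {kl kr : List K} {cl cr : List α} {c c' z : α}
    (h : kl.length = cl.length) {y : K} (hz : childFor (kl ++ kr) (cl ++ c' :: cr) y = some z) :
    (z = c' ∧ childFor (kl ++ kr) (cl ++ c :: cr) y = some c) ∨
      childFor (kl ++ kr) (cl ++ c :: cr) y = some z := by
  rw [childFor_append h] at hz ⊢
  split_ifs at hz ⊢ with hle
  · cases kr with
    | nil => exact .inl ⟨by simpa [childFor, eq_comm] using hz, rfl⟩
    | cons k kr =>
      simp only [childFor] at hz ⊢
      split_ifs at hz ⊢ with hk
      · exact .inl ⟨(Option.some.inj hz).symm, rfl⟩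
      · exact .inr hz
  · exact .inr hz

theorem childFor_replace_two {kl kr : List K} {cl cr : List α} {c l r z : α} {k : K}
    (h : kl.length = cl.length) (hkr : ∀ k' ∈ kr, k < k') {y : K}
    (hz : childFor (kl ++ k :: kr) (cl ++ l :: r :: cr) y = some z) :
    (z = l ∧ y < k ∧ childFor (kl ++ kr) (cl ++ c :: cr) y = some c) ∨
      (z = r ∧ k ≤ y ∧ childFor (kl ++ kr) (cl ++ c :: cr) y = some c) ∨
      childFor (kl ++ kr) (cl ++ c :: cr) y = some z := by
  rw [childFor_append h] at hz ⊢
  split_ifs at hz ⊢ with hle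
  · simp only [childFor] at hz
    split_ifs at hz with hk
    · refine .inl ⟨(Option.some.inj hz).symm, hk, ?_⟩
      cases kr with
      | nil => rfl
      | cons k' kr => simp [childFor, hk.trans (hkr k' (by simp))]
    · right
      cases kr with
      | nil => exact .inl ⟨by simpa [childFor, eq_comm] using hz, not_lt.1 hk, rfl⟩
      | cons k' kr =>
        simp only [childFor] at hz ⊢
        split_ifs at hz ⊢ with hk'
        · exact .inl ⟨(Option.some.inj hz).symm, not_lt.1 hk, rfl⟩
        · exact .inr hz
  · exact .inr (.inr hz)

theorem childFor_split_left {kl kr : List K} {cl cr : List α} {c z : α} {x y : K}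
    (h : kl.length = cl.length) (hy : y < x) (hz : childFor kl (cl ++ [c]) y = some z) :
    childFor (kl ++ x :: kr) (cl ++ c :: cr) y = some z := by
  rw [← List.append_nil kl, childFor_append h] at hz
  rw [childFor_append h]
  split_ifs at hz ⊢ with hle
  · simpa [childFor, hy] using hz
  · exact hz

theorem childFor_split_right {kl kr : List K} {cl cr : List α} {c z : α} {x y : K}
    (h : kl.length = cl.length) (hkl : ∀ k ∈ kl, k < x) (hy : x ≤ y)
    (hz : childFor kr cr y = some z) :
    childFor (kl ++ x :: kr) (cl ++ c :: cr) y = some z := by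
  rw [childFor_append h, if_pos fun k hk => ((hkl k hk).trans_le hy).le]
  simpa [childFor, not_lt.2 hy] using hz

theorem Sep.bounds {F : α → List (Entry K V)} {kl kr : List K} {cl cr : List α} {c : α}
    (hl : kl.length = cl.length) (h : Sep F (kl ++ kr) (cl ++ c :: cr)) {x : Entry K V}
    (hx : x ∈ F c) : (∀ k ∈ kl, k < x.key) ∧ ∀ k ∈ kr, x.key ≤ k := by
  rw [sep_append hl] at h
  refine ⟨fun k hk => (h.2.2 k hk).2 c (by simp) x hx, ?_⟩
  cases kr with
  | nil => simp
  | cons k kr =>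
    have := h.2.1.1 x hx
    simpa [this] using fun k' hk' => this.trans (h.2.1.2.1 k' hk').le

/-! ### Linkage between an s-node and its children -/

/-- The d-tree `d` of an s-node with children `cs` is well-formed, its s-keys lead to the children
and separate their keys; `last` is the pointer to the last child. -/
structure Linkage (p : Params) {n : ℕ} (last : Option ℕ) (d : DTree K V) (cs : List (STree K V n)) :
    Prop where
  ok : d.OK p last
  ptrs : (sKeys d.entries).map Entry.ptr ++ [last] = cs.map fun c => some (STree.addr n c)
  sep : Sep (STree.entries n) ((sKeys d.entries).map Entry.key) cs

variable {p : Params} {n : ℕ} {last : Option ℕ} {d : DTree K V} {cs : List (STree K V n)}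

theorem Linkage.length_eq (h : Linkage p last d cs) :
    cs.length = (sKeys d.entries).length + 1 := by
  simpa using (congrArg List.length h.ptrs).symm

/-- The pointer equation determines `last` as the address of the last child, so quantifying over
`last` costs nothing. -/
theorem linkage_iff : (∃ last, Linkage p last d cs) ↔ d.SizeReq p ∧ d.IsBPlus ∧ Linked d cs := by
  rw [DTree.sizeReq_iff, DTree.isBPlus_iff]
  have hsep (hl : cs.length = (sKeys d.entries).length + 1)
      (hs : Ascending (sKeys d.entries)) :
      Sep (STree.entries n) ((sKeys d.entries).map Entry.key) cs ↔
      (∀ (i : ℕ) (e : Entry K V) (c : STree K V n), (sKeys d.entries)[i]? = some e →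
        cs[i]? = some c → ∀ x ∈ STree.entries n c, x.key ≤ e.key) ∧
      (∀ (i : ℕ) (e : Entry K V) (c : STree K V n), (sKeys d.entries)[i]? = some e →
        cs[i + 1]? = some c → ∀ x ∈ STree.entries n c, e.key < x.key) := by
    rw [sep_iff_getElem? (by simpa using hl), ← ascending_iff]
    simp only [hs, true_and, List.getElem?_map, Option.map_eq_some_iff, forall_exists_index,
      and_imp]
    constructor
    · rintro ⟨h1, h2⟩
      exact ⟨fun i e c he => h1 i _ c e he rfl, fun i e c he => h2 i _ c e he rfl⟩
    · rintro ⟨h1, h2⟩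
      exact ⟨fun i k c e he hk => hk ▸ h1 i e c he, fun i k c e he hk => hk ▸ h2 i e c he⟩
  constructor
  · rintro ⟨last, h⟩
    have hlast : cs.getLast?.map (STree.addr n) = last := by
      have := congrArg List.getLast? h.ptrs
      simp only [List.getLast?_append, List.getLast?_singleton, Option.some_or,
        List.getLast?_map] at this
      cases hc : cs.getLast? with
      | none => simp [hc] at this
      | some c => simpa [hc, eq_comm] using this
    obtain ⟨h1, h2⟩ := (hsep h.length_eq (List.Pairwise.filter _ h.ok.ascending)).1 h.sep
    exact ⟨h.ok.size, ⟨h.ok.hasKey, h.ok.bplus⟩, by rw [hlast]; exact h.ptrs, h1, h2,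
      by rw [hlast]; exact (ptrOK_iff _ _).1 h.ok.ptr⟩
  · rintro ⟨h1, ⟨h2, h3⟩, h4, h5, h6, h7⟩
    exact ⟨_, ⟨h1, h2, h3, (ptrOK_iff _ _).2 h7⟩, h4, (hsep
      (by simpa using (congrArg List.length h4).symm)
      (List.Pairwise.filter _ h3.ascending)).2 ⟨h5, h6⟩⟩

/-- The invariant of the s-node at height `n` and everything below it; a leaf s-node that is the root
may be empty. -/
def STree.OK (p : Params) : (n : ℕ) → (isRoot : Bool) → STree K V n → Prop
  | 0, isRoot, ⟨_, d⟩ => d.OK p none ∧ (∀ e ∈ d.entries, e.ptr = none) ∧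
      (if isRoot then 0 else p.s / 2) ≤ d.size ∧ d.size ≤ p.s
  | n + 1, isRoot, ⟨_, d, cs⟩ => (∃ last, Linkage p last d cs) ∧ d.size ≤ p.s ∧
      (if isRoot then 1 else (p.f - 1) / 2) ≤ (sKeys d.entries).length ∧
      (sKeys d.entries).length ≤ p.f - 1 ∧ ∀ c ∈ cs, STree.OK p n false c

/-- The lower bounds are positive: `s / 2 ≥ f ≥ 3` for leaf s-nodes and `(f - 1) / 2 ≥ 1` for the
others. -/
theorem STree.OK.entries_ne_nil (hf : 3 ≤ p.f) (hfs : 2 * p.f ≤ p.s) : {n : ℕ} →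
    {t : STree K V n} → STree.OK p n false t → STree.entries n t ≠ []
  | 0, ⟨_, d⟩, h => by
    have := h.2.2.1
    rintro h0
    simp only [STree.entries] at h0
    simp [DTree.size, h0] at this
    omega
  | n + 1, ⟨_, d, cs⟩, h => by
    have h1 := h.2.2.1
    rintro h0
    simp only [STree.entries, List.append_eq_nil_iff] at h0
    simp [h0.1, sKeys] at h1
    omega

theorem STree.OK.of_requirements : {n : ℕ} → {isRoot : Bool} → {t : STree K V n} →
    STree.SizeReq p n isRoot t → STree.StructReq p n isRoot t → STree.AllBPlus n t →
    STree.CrossLinked n t → STree.OK p n isRoot t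
  | 0, isRoot, ⟨_, d⟩, h1, _, h3, h4 => by
    obtain ⟨h5, h6, h7⟩ := h1
    obtain ⟨h8, h9⟩ := (DTree.isBPlus_iff d).1 h3
    refine ⟨⟨(DTree.sizeReq_iff p d).1 h5, h8, h9, (ptrOK_none_iff h4.1).2 h4.2⟩, h4.1, ?_, h7⟩
    split_ifs at h6 ⊢ <;> omega
  | n + 1, isRoot, ⟨_, d, cs⟩, h1, h2, h3, h4 => by
    obtain ⟨a1, -, a3, a4⟩ := h1
    obtain ⟨-, -, b3, b4, b5⟩ := h2
    exact ⟨linkage_iff.2 ⟨a1, h3.1, h4.1⟩, a3, b3, b4, fun c hc =>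
      STree.OK.of_requirements (a4 c hc) (b5 c hc) (h3.2 c hc) (h4.2 c hc)⟩

/-- The bounds on children follow from those on s-keys, as there is one more child than s-keys and
`f / 2 ≤ (f - 1) / 2 + 1`. An s-key makes a non-leaf s-node nonempty, so the nonemptiness assumption
only matters for a leaf root. -/
theorem STree.OK.requirements (hf : 3 ≤ p.f) (hfs : 2 * p.f ≤ p.s) : {n : ℕ} → {isRoot : Bool} →
    {t : STree K V n} → STree.OK p n isRoot t → STree.entries n t ≠ [] →
    STree.SizeReq p n isRoot t ∧ STree.StructReq p n isRoot t ∧ STree.AllBPlus n t ∧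
      STree.CrossLinked n t
  | 0, isRoot, ⟨_, d⟩, h, h0 => by
    obtain ⟨h1, h2, h3, h4⟩ := h
    have : 1 ≤ d.size := List.length_pos_iff.2 h0
    refine ⟨⟨(DTree.sizeReq_iff p d).2 h1.size, ?_, h4⟩, trivial,
      (DTree.isBPlus_iff d).2 ⟨h1.hasKey, h1.bplus⟩, h2, (ptrOK_none_iff h2).1 h1.ptr⟩
    split_ifs at h3 ⊢ <;> omega
  | n + 1, isRoot, ⟨_, d, cs⟩, h, _ => by
    obtain ⟨h1, h2, h3, h4, h5⟩ := h
    obtain ⟨a1, a2, a3⟩ := linkage_iff.1 h1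
    obtain ⟨last, h1⟩ := h1
    have ih := fun c hc => (h5 c hc).requirements hf hfs ((h5 c hc).entries_ne_nil hf hfs)
    have hl := h1.length_eq
    have hd : (sKeys d.entries).length ≤ d.size := length_sKeys_le d.entries
    refine ⟨⟨a1, ?_, h2, fun c hc => (ih c hc).1⟩,
      ⟨?_, ?_, h3, h4, fun c hc => (ih c hc).2.1⟩, ⟨a2, fun c hc => (ih c hc).2.2.1⟩,
      a3, fun c hc => (ih c hc).2.2.2⟩
    · split_ifs at h3 <;> omega
    · split_ifs at h3 ⊢ <;> omega
    · omega

/-- The child on the search path of a key `y` that is not an s-key. -/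
theorem Linkage.exists_child (h : Linkage p last d cs) {y : K}
    (hy : ∀ e ∈ d.entries, e.key ≠ y) :
    ∃ SL SR CL c CR, sKeys d.entries = SL ++ SR ∧ cs = CL ++ c :: CR ∧
      SL.length = CL.length ∧ SR.length = CR.length ∧ (∀ e ∈ SL, e.key < y) ∧
      (∀ e ∈ SR, y < e.key) ∧ SL.map Entry.ptr = CL.map (fun c => some (STree.addr n c)) ∧
      SR.map Entry.ptr ++ [last] = (c :: CR).map (fun c => some (STree.addr n c)) ∧
      d.route y = some (STree.addr n c) := by
  have hs : Ascending (sKeys d.entries) := List.Pairwise.filter _ h.ok.ascending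
  obtain ⟨SL, SR, hS, h1, h2⟩ := hs.exists_cut fun x hx => hy x (List.mem_of_mem_filter hx)
  have hl := h.length_eq
  obtain ⟨CL, c, CR, rfl, hCL⟩ := exists_append_cons cs SL.length (by rw [hl, hS]; simp)
  have hSR : SR.length = CR.length := by rw [hS] at hl; simp at hl; omega
  have hp := h.ptrs
  rw [hS, List.map_append, List.map_append, List.append_assoc] at hp
  obtain ⟨hp1, hp2⟩ := List.append_inj hp (by simp [hCL])
  refine ⟨SL, SR, CL, c, CR, hS, rfl, hCL.symm, hSR, h1, h2, hp1, hp2, ?_⟩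
  have hsome : ∀ e ∈ SR, e.ptr.isSome := by
    intro e he
    have : e ∈ sKeys d.entries := by rw [hS]; exact List.mem_append_right _ he
    exact (List.mem_filter.1 this).2
  have hhead := head?_map_ptr_append SR hsome last
  rw [hp2] at hhead
  rw [DTree.route, h.ok.lastPtr_eq, hS, List.filter_append,
    List.filter_eq_nil_iff.2 (by simpa using fun x hx => (h1 x hx).le),
    List.filter_eq_self.2 (by simpa using h2), List.nil_append]
  simpa [eq_comm] using hhead

theorem Linkage.insert (hB : 3 ≤ p.B) (hB' : 3 ≤ p.B') (h : Linkage p last d cs) {e : Entry K V}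
    (he : e.ptr = none) (hy : ∀ x ∈ d.entries, x.key ≠ e.key) : Linkage p last (d.insert p e) cs := by
  have hs : sKeys (d.insert p e).entries = sKeys d.entries := by
    rw [DTree.entries_insert hB hB' h.ok hy, sKeys_insertSorted he]
  exact ⟨h.ok.insert hB hB' he hy, hs ▸ h.ptrs, hs ▸ h.sep⟩

theorem Linkage.build_sKeys (hB : 3 ≤ p.B) (hB' : 3 ≤ p.B') (h : Linkage p last d cs) :
    Linkage p last (DTree.build p last (sKeys d.entries)) cs ∧
      (DTree.build p last (sKeys d.entries)).entries = sKeys d.entries := by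
  obtain ⟨h1, h2⟩ := DTree.build_spec hB hB' last
    (show Ascending (sKeys d.entries) from List.Pairwise.filter _ h.ok.ascending)
  exact ⟨⟨h1, by rw [h2, sKeys_sKeys]; exact h.ptrs, by rw [h2, sKeys_sKeys]; exact h.sep⟩, h2⟩

/-- The median's pointer leads to the last child of the lower piece and so becomes the default
there; the upper piece keeps the old default. -/
theorem Linkage.split (hB : 3 ≤ p.B) (hB' : 3 ≤ p.B') {A S : List (Entry K V)} {x : Entry K V}
    {CL CR : List (STree K V n)} {c : STree K V n} (h : Linkage p last d (CL ++ c :: CR))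
    (hd : d.entries = A ++ x :: S) (hsome : ∀ e ∈ d.entries, e.ptr.isSome)
    (hl : A.length = CL.length) :
    (Linkage p x.ptr (DTree.build p x.ptr A) (CL ++ [c]) ∧ (DTree.build p x.ptr A).entries = A) ∧
    Linkage p last (DTree.build p last S) CR ∧ (DTree.build p last S).entries = S := by
  have hasc := h.ok.ascending
  have hsk : sKeys d.entries = d.entries := sKeys_eq_self hsome
  have hsep := h.sep
  have hp := h.ptrs
  rw [hsk, hd] at hsep hp
  rw [hd] at hsome hasc
  rw [Ascending, List.pairwise_append, List.pairwise_cons] at hasc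
  have hA : sKeys A = A := sKeys_eq_self fun e he => hsome e (by simp [he])
  have hS : sKeys S = S := sKeys_eq_self fun e he => hsome e (by simp [he])
  obtain ⟨a1, a2⟩ := DTree.build_spec hB hB' x.ptr hasc.1
  obtain ⟨b1, b2⟩ := DTree.build_spec hB hB' last hasc.2.1.2
  rw [List.map_append, List.map_append, List.append_assoc] at hp
  obtain ⟨hp1, hp2⟩ := List.append_inj hp (by simp [hl])
  simp only [List.map_cons, List.cons_append, List.cons.injEq] at hp2
  rw [List.map_append, List.map_cons] at hsep
  obtain ⟨s1, s2, -, -⟩ := hsep.split (by simpa using hl)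
  exact ⟨⟨⟨a1, by rw [a2, hA, hp1]; simp [hp2.1], by rw [a2, hA]; exact s1⟩, a2⟩,
    ⟨b1, by rw [b2, hS, hp2.2], by rw [b2, hS]; exact s2⟩, b2⟩

end order

/-! ### Conservation of pairs and freshness of addresses -/

/-- The key-value pairs of a list of entries. -/
def pairsOf (es : List (Entry K V)) : List (K × V) := es.map fun e => (e.key, e.val)

@[simp] theorem pairsOf_append (as bs : List (Entry K V)) :
    pairsOf (as ++ bs) = pairsOf as ++ pairsOf bs := List.map_append

@[simp] theorem pairsOf_cons (e : Entry K V) (es : List (Entry K V)) :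
    pairsOf (e :: es) = (e.key, e.val) :: pairsOf es := rfl

@[simp] theorem pairsOf_nil : pairsOf ([] : List (Entry K V)) = [] := rfl

theorem map_fst_pairsOf (es : List (Entry K V)) : (pairsOf es).map Prod.fst = es.map Entry.key := by
  simp [pairsOf]

theorem pairsOf_insertSorted_perm [LinearOrder K] (e : Entry K V) (es : List (Entry K V)) :
    (pairsOf (insertSorted e es)).Perm ((e.key, e.val) :: pairsOf es) :=
  (insertSorted_perm e es).map _

/-- `L'` arises from `L` by adding distinct new addresses between `a` and `a + n`. -/
def AddrExt (a n : ℕ) (L L' : List ℕ) : Prop :=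
  ∃ N : List ℕ, L'.Perm (L ++ N) ∧ N.Nodup ∧ ∀ x ∈ N, a ≤ x ∧ x ≤ a + n

theorem AddrExt.refl (a n : ℕ) (L : List ℕ) : AddrExt a n L L :=
  ⟨[], by simp, .nil, by simp⟩

/-- Here `X` stands for the addresses outside the changed child: the s-node itself and the other
subtrees. -/
theorem AddrExt.context {a n : ℕ} {L L' : List ℕ} (h : AddrExt a n L L') {m : ℕ} (hm : n ≤ m)
    {M M' X : List ℕ} (hM : M.Perm (L ++ X)) (hM' : M'.Perm (L' ++ X)) : AddrExt a m M M' := by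
  obtain ⟨N, h1, h2, h3⟩ := h
  refine ⟨N, ?_, h2, fun x hx => ⟨(h3 x hx).1, (h3 x hx).2.trans (by omega)⟩⟩
  rw [List.perm_iff_count] at *
  intro z
  have := h1 z; have := hM z; have := hM' z
  simp only [List.count_append] at *
  omega

/-- The address `a + (n + 1)` exceeds all those created below, which are at most `a + n`. -/
theorem AddrExt.cons {a n : ℕ} {L L' L'' : List ℕ} (h : AddrExt a n L L')
    (h' : L''.Perm ((a + (n + 1)) :: L')) : AddrExt a (n + 1) L L'' := by
  obtain ⟨N, h1, h2, h3⟩ := h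
  refine ⟨(a + (n + 1)) :: N, h'.trans ((h1.cons _).trans List.perm_middle.symm), ?_, ?_⟩
  · exact List.nodup_cons.2 ⟨fun hx => by have := (h3 _ hx).2; omega, h2⟩
  · rintro x hx
    rcases List.mem_cons.1 hx with rfl | hx
    · omega
    · have := h3 x hx; omega

theorem AddrExt.nodup {a n : ℕ} {L L' : List ℕ} (h : AddrExt a n L L') (hL : L.Nodup)
    (ha : ∀ x ∈ L, x < a) : L'.Nodup := by
  obtain ⟨N, h1, h2, h3⟩ := h
  rw [h1.nodup_iff, List.nodup_append]
  refine ⟨hL, h2, fun x hx y hy => ?_⟩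
  have := ha x hx; have := h3 y hy; omega

theorem AddrExt.le {a n : ℕ} {L L' : List ℕ} (h : AddrExt a n L L')
    (ha : ∀ x ∈ L, x < a) : ∀ x ∈ L', x ≤ a + n := by
  obtain ⟨N, h1, h2, h3⟩ := h
  intro x hx
  rcases List.mem_append.1 (h1.mem_iff.1 hx) with hx | hx
  · have := ha x hx; omega
  · exact (h3 x hx).2

/-! ### Insertion at a given height of the s-tree -/

section order

variable [LinearOrder K]

/-- All s-nodes above height `h` on the search path of `y` store only s-keys. -/
def PathClean (h : ℕ) (y : K) : (n : ℕ) → STree K V n → Prop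
  | 0, _ => True
  | n + 1, ⟨_, d, cs⟩ => h < n + 1 → (∀ e ∈ d.entries, e.ptr.isSome) ∧
      ∀ c, childFor ((sKeys d.entries).map Entry.key) cs y = some c → PathClean h y n c

theorem pathClean_of_le {h : ℕ} {y : K} : {n : ℕ} → {t : STree K V n} → n ≤ h → PathClean h y n t
  | 0, _, _ => trivial
  | _ + 1, ⟨_, _, _⟩, hn => fun h' => absurd h' (by omega)

/-- What the insertion of `e` as an r-key at height `h` of the search path below `t` produces. -/
def STree.InsertSpec (p : Params) (a h : ℕ) (e : Entry K V) (n : ℕ) (isRoot : Bool) (t : STree K V n) :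
    SRes K V n × List (Entry K V) → Prop
  | (.one t', fl) => STree.OK p n isRoot t' ∧ STree.addr n t' = STree.addr n t ∧
      (pairsOf (STree.entries n t') ++ pairsOf fl).Perm
        ((e.key, e.val) :: pairsOf (STree.entries n t)) ∧
      AddrExt a n (STree.addrs n t) (STree.addrs n t') ∧
      (∀ h' y, h ≤ h' → PathClean h' y n t → PathClean h' y n t') ∧
      ∀ x ∈ fl, x.ptr = none ∧ 1 ≤ h ∧ PathClean (h - 1) x.key n t'
  | (.two l k v r, fl) => fl = [] ∧ STree.OK p n false l ∧ STree.OK p n false r ∧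
      STree.addr n r = STree.addr n t ∧
      (pairsOf (STree.entries n l) ++ (k, v) :: pairsOf (STree.entries n r)).Perm
        ((e.key, e.val) :: pairsOf (STree.entries n t)) ∧
      AddrExt a n (STree.addrs n t) (STree.addrs n l ++ STree.addrs n r) ∧
      (∀ x ∈ STree.entries n l, x.key ≤ k) ∧ (∀ x ∈ STree.entries n r, k < x.key) ∧
      ∀ h' y, h ≤ h' → PathClean h' y n t →
        (y < k → PathClean h' y n l) ∧ (k ≤ y → PathClean h' y n r)

/-- An oversize leaf s-node has exactly `s + 1` keys; without the median, `⌊(s+1)/2⌋` and `⌊s/2⌋`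
remain. -/
theorem STree.insertSpec_zero {p : Params} (hB : 3 ≤ p.B) (hB' : 3 ≤ p.B') {a h addr : ℕ}
    {e : Entry K V} (hp : e.ptr = none) {isRoot : Bool} {d : DTree K V}
    (hok : STree.OK p 0 isRoot ⟨addr, d⟩) (he : ∀ x ∈ d.entries, x.key ≠ e.key) :
    STree.InsertSpec p a h e 0 isRoot ⟨addr, d⟩ (STree.insertAt p a h e 0 ⟨addr, d⟩) := by
  obtain ⟨h1, h2, h3, h4⟩ := hok
  have hent := DTree.entries_insert hB hB' h1 he
  have hsize : (d.insert p e).size = d.size + 1 := by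
    rw [DTree.size, hent, length_insertSorted, DTree.size]
  have hnone : ∀ x ∈ (d.insert p e).entries, x.ptr = none := by
    rw [hent]
    intro x hx
    rcases mem_insertSorted.1 hx with rfl | hx
    · exact hp
    · exact h2 x hx
  have hperm := pairsOf_insertSorted_perm e d.entries
  rw [← hent] at hperm
  rw [STree.insertAt]
  split_ifs with hle
  · refine ⟨⟨h1.insert hB hB' hp he, hnone, by omega, hle⟩, rfl, ?_, AddrExt.refl _ _ _,
      fun _ _ _ _ => trivial, by simp⟩
    simpa [STree.entries] using hperm
  · have hasc := (h1.insert hB hB' hp he).ascending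
    obtain ⟨A, x, S, hcut, hlen⟩ := exists_append_cons (d.insert p e).entries
      ((d.insert p e).entries.length / 2) (by rw [DTree.size] at hsize; omega)
    have htot : p.s + 1 = A.length + 1 + S.length := by
      have : (d.insert p e).size = A.length + 1 + S.length := by rw [DTree.size, hcut]; simp; omega
      omega
    have hlen' : A.length = (p.s + 1) / 2 := by
      rw [hlen]; rw [DTree.size] at hsize; unfold DTree.size at *; congr 1; omega
    have h5 : (d.insert p e).entries.take ((d.insert p e).entries.length / 2) = A := by
      rw [← hlen, hcut, List.take_left]
    have h6 : (d.insert p e).entries.drop ((d.insert p e).entries.length / 2 + 1) = S := by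
      rw [← hlen, hcut, show A ++ x :: S = (A ++ [x]) ++ S by simp, List.drop_left' (by simp)]
    have h7 : (d.insert p e).entries[(d.insert p e).entries.length / 2]? = some x := by
      rw [← hlen, hcut]; simp
    simp only [splitLeaf, h5, h6, h7]
    rw [hcut] at hasc hperm hnone
    rw [Ascending, List.pairwise_append, List.pairwise_cons] at hasc
    obtain ⟨a1, a2⟩ := DTree.build_spec hB hB' none hasc.1
    obtain ⟨b1, b2⟩ := DTree.build_spec hB hB' none hasc.2.1.2
    refine ⟨rfl, ⟨a1, ?_, ?_, ?_⟩, ⟨b1, ?_, ?_, ?_⟩, rfl, ?_, ?_, ?_, ?_,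
      fun _ _ _ _ => ⟨fun _ => trivial, fun _ => trivial⟩⟩
    · rw [a2]; exact fun y hy => hnone y (by simp [hy])
    · simp [DTree.size, a2]; omega
    · simp [DTree.size, a2]; omega
    · rw [b2]; exact fun y hy => hnone y (by simp [hy])
    · simp [DTree.size, b2]; omega
    · simp [DTree.size, b2]; omega
    · simpa [STree.entries, a2, b2] using hperm
    · exact ⟨[a], by simpa [STree.addrs] using List.Perm.swap _ _ _, by simp, by simp⟩
    · simp only [STree.entries, a2]
      exact fun y hy => (hasc.2.2 y hy x (by simp)).le
    · simp only [STree.entries, b2]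
      exact hasc.2.1.1

/-- The new r-key does not affect s-keys or linkage. After a merge the s-node holds only s-keys, so
the paths of the removed keys are clean one level further down; below this s-node the condition is
empty. -/
theorem STree.insertSpec_here {p : Params} (hB : 3 ≤ p.B) (hB' : 3 ≤ p.B') (hf : 3 ≤ p.f)
    (hfs : 2 * p.f ≤ p.s) {a n addr : ℕ}
    {e : Entry K V} (hp : e.ptr = none) {isRoot : Bool} {d : DTree K V} {cs : List (STree K V n)}
    (hok : STree.OK p (n + 1) isRoot ⟨addr, d, cs⟩) (he : ∀ x ∈ d.entries, x.key ≠ e.key) :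
    STree.InsertSpec p a (n + 1) e (n + 1) isRoot ⟨addr, d, cs⟩
      (STree.insertAt p a (n + 1) e (n + 1) ⟨addr, d, cs⟩) := by
  obtain ⟨⟨last, h1⟩, h2, h3, h4, h5⟩ := hok
  have hent := DTree.entries_insert hB hB' h1.ok he
  have hsk : sKeys (d.insert p e).entries = sKeys d.entries := by
    rw [hent, sKeys_insertSorted hp]
  have hperm := pairsOf_insertSorted_perm e d.entries
  rw [← hent] at hperm
  have hl := h1.insert hB hB' hp he
  have hclean : ∀ (t' : STree K V (n + 1)) (h' : ℕ) (y : K), n + 1 ≤ h' →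
      PathClean h' y (n + 1) ⟨addr, d, cs⟩ → PathClean h' y (n + 1) t' :=
    fun _ _ _ hh _ => pathClean_of_le hh
  rw [STree.insertAt, if_pos rfl]
  dsimp only
  split_ifs with hle
  · refine ⟨⟨⟨last, hl⟩, hle, hsk ▸ h3, hsk ▸ h4, h5⟩, rfl, ?_, AddrExt.refl _ _ _,
      hclean _, by simp⟩
    simpa [STree.entries] using hperm.append_right _
  · obtain ⟨b1, b2⟩ := hl.build_sKeys hB hB'
    rw [hl.ok.lastPtr_eq]
    refine ⟨⟨⟨last, b1⟩, ?_, ?_, ?_, h5⟩, rfl, ?_, AddrExt.refl _ _ _, hclean _, ?_⟩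
    · rw [DTree.size, b2, hsk]; omega
    · rw [b2, sKeys_sKeys, hsk]; exact h3
    · rw [b2, sKeys_sKeys, hsk]; exact h4
    · have hsr := (sKeys_perm_rKeys (d.insert p e).entries).map fun e : Entry K V => (e.key, e.val)
      have hsr : (pairsOf _).Perm (pairsOf _) := hsr
      classical
      simp only [STree.entries, b2, pairsOf_append, List.perm_iff_count] at *
      intro z
      have := hsr z; have := hperm z
      simp only [List.count_append, List.count_cons] at *
      omega
    · intro x hx
      refine ⟨by simpa [rKeys] using (List.mem_filter.1 hx).2, by omega, fun _ => ⟨?_, ?_⟩⟩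
      · rw [b2]
        exact fun y hy => (List.mem_filter.1 hy).2
      · exact fun c _ => pathClean_of_le (by omega)

theorem forall_mem_replace {α : Type*} {P : α → Prop} {cl cr : List α} {c : α} {N : List α}
    (h : ∀ x ∈ cl ++ c :: cr, P x) (hN : ∀ x ∈ N, P x) : ∀ x ∈ cl ++ (N ++ cr), P x := by
  simp only [List.mem_append, List.mem_cons] at *
  rintro x (hx | hx | hx)
  · exact h x (.inl hx)
  · exact hN x hx
  · exact h x (.inr (.inr hx))

theorem STree.insertSpec_one {p : Params} {a h n addr : ℕ} {e : Entry K V} {isRoot : Bool}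
    {d : DTree K V} {SL SR : List (Entry K V)} {CL CR : List (STree K V n)} {c c₁ : STree K V n}
    {fl : List (Entry K V)} (hok : STree.OK p (n + 1) isRoot ⟨addr, d, CL ++ c :: CR⟩)
    (hS : sKeys d.entries = SL ++ SR) (hl : SL.length = CL.length)
    (h1 : ∀ x ∈ SL, x.key < e.key) (h2 : ∀ x ∈ SR, e.key < x.key)
    (hclean : ∀ x ∈ d.entries, x.ptr.isSome)
    (hnd : ∀ x ∈ d.entries, ∀ y ∈ STree.entries n c, y.key ≠ x.key)
    (hc : STree.InsertSpec p a h e n false c (.one c₁, fl)) :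
    STree.InsertSpec p a h e (n + 1) isRoot ⟨addr, d, CL ++ c :: CR⟩
      (.one ⟨addr, d, CL ++ c₁ :: CR⟩, fl) := by
  obtain ⟨⟨last, o1⟩, o2, o3, o4, o5⟩ := hok
  obtain ⟨c1, c2, c3, c4, c5, c6⟩ := hc
  have hsep := o1.sep
  have hl' : (SL.map Entry.key).length = CL.length := by simpa using hl
  rw [hS, List.map_append] at hsep
  have hkl : ∀ k ∈ SL.map Entry.key, k < e.key := by simpa using h1
  have hkr : ∀ k ∈ SR.map Entry.key, e.key < k := by simpa using h2
  -- Conservation of pairs shows that no foreign key can enter the child or the list of removed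
  -- keys.
  have hmem : ∀ x ∈ STree.entries n c₁ ++ fl, x.key = e.key ∨ ∃ y ∈ STree.entries n c, y.key = x.key := by
    intro x hx
    have hx' : x.key ∈ ((e.key, e.val) :: pairsOf (STree.entries n c)).map Prod.fst := by
      refine (c3.map Prod.fst).mem_iff.1 ?_
      rw [← pairsOf_append, map_fst_pairsOf]
      exact List.mem_map_of_mem hx
    simpa [map_fst_pairsOf] using hx'
  refine ⟨⟨⟨last, o1.ok, ?_, ?_⟩, o2, o3, o4, ?_⟩, rfl, ?_, ?_, ?_, ?_⟩
  · rw [o1.ptrs]; simp [c2]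
  · rw [hS, List.map_append]
    exact hsep.replace hl' hkl (fun k hk => (hkr k hk).le) fun x hx => hmem x (by simp [hx])
  · exact forall_mem_replace (N := [c₁]) o5 (by simpa using c1)
  · classical
    simp only [STree.entries, List.flatMap_append, List.flatMap_cons, pairsOf_append,
      List.perm_iff_count] at *
    intro z
    have := c3 z
    simp only [List.count_append, List.count_cons] at *
    omega
  · refine c4.context (Nat.le_succ n) (X := addr :: (CL.flatMap (fun c => STree.addrs n c) ++
      CR.flatMap (fun c => STree.addrs n c))) ?_ ?_
    all_goals
      rw [List.perm_iff_count]
      intro z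
      simp only [STree.addrs, List.flatMap_append, List.flatMap_cons, List.count_append,
        List.count_cons]
      omega
  · intro h' y hh hy hn
    refine ⟨hclean, fun z hz => ?_⟩
    have hy' := (hy hn).2
    rw [hS, List.map_append] at hz hy'
    rcases childFor_replace (c := c) hl' hz with ⟨rfl, hz'⟩ | hz
    · exact c5 h' y hh (hy' c hz')
    · exact hy' z hz
  · intro x hx
    obtain ⟨x1, x2, x3⟩ := c6 x hx
    refine ⟨x1, x2, fun _ => ⟨hclean, fun z hz => ?_⟩⟩
    -- A removed key is that of `e` or was stored below `c`. Distinctness from the s-keys makes the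
    -- upper bound strict, so its search path runs through `c₁`.
    have hb : (∀ k ∈ SL.map Entry.key, k < x.key) ∧ ∀ k ∈ SR.map Entry.key, x.key < k := by
      rcases hmem x (by simp [hx]) with hx | ⟨y, hy, hyx⟩
      · rw [hx]; exact ⟨hkl, hkr⟩
      · obtain ⟨b1, b2⟩ := hsep.bounds hl' hy
        rw [hyx] at b1 b2
        refine ⟨b1, fun k hk => lt_of_le_of_ne (b2 k hk) ?_⟩
        obtain ⟨s, hs, rfl⟩ := List.mem_map.1 hk
        have : s ∈ sKeys d.entries := by rw [hS]; simp [hs]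
        exact hyx ▸ hnd s (List.mem_of_mem_filter this) y hy
    rw [hS, List.map_append, childFor_eq_some hl' hb.1 hb.2] at hz
    exact Option.some.inj hz ▸ x3

end order

section order

variable [LinearOrder K]

/-- With exactly `f` entries, all of them s-keys, the median leaves `⌊f/2⌋` and `⌊(f-1)/2⌋` s-keys.
The child next to the median goes to the lower piece. -/
theorem splitNode_spec {p : Params} (hB : 3 ≤ p.B) (hB' : 3 ≤ p.B') (hf : 3 ≤ p.f)
    (hfs : 2 * p.f ≤ p.s) {n addr : ℕ} (a : ℕ) {last : Option ℕ} {d : DTree K V}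
    {cs : List (STree K V n)} (h : Linkage p last d cs) (hsome : ∀ e ∈ d.entries, e.ptr.isSome)
    (hlen : d.entries.length = p.f) (hkids : ∀ c ∈ cs, STree.OK p n false c) :
    ∃ l k v r, splitNode p a addr d cs = .two l k v r ∧
      STree.OK p (n + 1) false l ∧ STree.OK p (n + 1) false r ∧ STree.addr (n + 1) r = addr ∧
      (pairsOf (STree.entries (n + 1) l) ++ (k, v) :: pairsOf (STree.entries (n + 1) r)).Perm
        (pairsOf (STree.entries (n + 1) ⟨addr, d, cs⟩)) ∧
      (STree.addrs (n + 1) l ++ STree.addrs (n + 1) r).Perm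
        (a :: STree.addrs (n + 1) ⟨addr, d, cs⟩) ∧
      (∀ x ∈ STree.entries (n + 1) l, x.key ≤ k) ∧ (∀ x ∈ STree.entries (n + 1) r, k < x.key) ∧
      ∀ h y, PathClean h y (n + 1) ⟨addr, d, cs⟩ →
        (y < k → PathClean h y (n + 1) l) ∧ (k ≤ y → PathClean h y (n + 1) r) := by
  have hsk : sKeys d.entries = d.entries := sKeys_eq_self hsome
  have hcl := h.length_eq
  obtain ⟨A, x, S, hcut, hA⟩ := exists_append_cons d.entries (p.f / 2) (by omega)
  obtain ⟨CL, c, CR, rfl, hCL⟩ := exists_append_cons cs (p.f / 2) (by rw [hcl, hsk]; omega)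
  have htot : p.f = A.length + 1 + S.length := by rw [← hlen, hcut]; simp; omega
  have hasc := h.ok.ascending
  have hsep := h.sep
  rw [hsk, hcut, List.map_append, List.map_cons] at hsep
  rw [hcut] at hasc
  obtain ⟨hfA, hfS⟩ := filter_lt_of_ascending hasc
  rw [← hcut] at hfA hfS
  obtain ⟨⟨a1, a2⟩, b1, b2⟩ := h.split hB hB' hcut hsome (by omega)
  have hsomeA : ∀ e ∈ A, e.ptr.isSome := fun e he => hsome e (by simp [hcut, he])
  have hsomeS : ∀ e ∈ S, e.ptr.isSome := fun e he => hsome e (by simp [hcut, he])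
  have hl' : (A.map Entry.key).length = CL.length := by simp; omega
  obtain ⟨-, -, s3, s4⟩ := hsep.split hl'
  rw [Ascending, List.pairwise_append, List.pairwise_cons] at hasc
  refine ⟨⟨a, DTree.build p x.ptr A, CL ++ [c]⟩, x.key, x.val,
    ⟨addr, DTree.build p last S, CR⟩, ?_, ⟨⟨_, a1⟩, ?_, ?_, ?_, ?_⟩, ⟨⟨_, b1⟩, ?_, ?_, ?_, ?_⟩, rfl,
    ?_, ?_, ?_, ?_, ?_⟩
  · have hx : d.entries[p.f / 2]? = some x := by rw [hcut, ← hA]; simp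
    simp only [splitNode, hsk, hlen, hx, hfA, hfS, h.ok.lastPtr_eq]
    rw [show CL ++ c :: CR = (CL ++ [c]) ++ CR by simp, List.take_left' (by simp [hCL]),
      List.drop_left' (by simp [hCL])]
  · rw [DTree.size, a2]; omega
  · rw [a2, sKeys_eq_self hsomeA]
    simp; omega
  · rw [a2, sKeys_eq_self hsomeA]; omega
  · intro z hz
    refine hkids z ?_
    rw [show CL ++ c :: CR = (CL ++ [c]) ++ CR by simp]
    exact List.mem_append_left _ hz
  · rw [DTree.size, b2]; omega
  · rw [b2, sKeys_eq_self hsomeS]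
    simp; omega
  · rw [b2, sKeys_eq_self hsomeS]; omega
  · exact fun z hz => hkids z (by simp [hz])
  · classical
    simp only [STree.entries, a2, b2, hcut, List.flatMap_append, List.flatMap_cons,
      List.flatMap_nil, List.append_nil, pairsOf_append, pairsOf_cons, List.perm_iff_count]
    intro z
    simp only [List.count_append, List.count_cons]
    omega
  · rw [List.perm_iff_count]
    intro z
    simp only [STree.addrs, List.flatMap_append, List.flatMap_cons, List.flatMap_nil,
      List.append_nil, List.count_append, List.count_cons]
    omega
  · intro y hy
    simp only [STree.entries, a2, List.mem_append (s := A)] at hy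
    rcases hy with hy | hy
    · exact (hasc.2.2 y hy x (by simp)).le
    · obtain ⟨c', hc', hy⟩ := List.mem_flatMap.1 hy
      exact s3 c' hc' y hy
  · intro y hy
    simp only [STree.entries, b2, List.mem_append (s := S)] at hy
    rcases hy with hy | hy
    · exact hasc.2.1.1 y hy
    · obtain ⟨c', hc', hy⟩ := List.mem_flatMap.1 hy
      exact s4 c' hc' y hy
  · intro h' y hy
    refine ⟨fun hyx hn => ⟨by rw [a2]; exact hsomeA, fun z hz => ?_⟩,
      fun hyx hn => ⟨by rw [b2]; exact hsomeS, fun z hz => ?_⟩⟩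
    all_goals
      refine (hy hn).2 z ?_
      rw [hsk, hcut, List.map_append, List.map_cons]
    · rw [a2, sKeys_eq_self hsomeA] at hz
      exact childFor_split_left hl' hyx hz
    · rw [b2, sKeys_eq_self hsomeS] at hz
      refine childFor_split_right hl' ?_ hyx hz
      simpa using fun y hy => hasc.2.2 y hy x (by simp)

/-- The parent is clean, so the promoted key enters a list of s-keys and the size is at most `f`. A
split below never comes with removed keys, so `fl` is empty and nothing waits while the parent is
split. -/
theorem STree.insertSpec_two {p : Params} (hB : 3 ≤ p.B) (hB' : 3 ≤ p.B') (hf : 3 ≤ p.f)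
    (hfs : 2 * p.f ≤ p.s) {a h n addr : ℕ} {e : Entry K V} {isRoot : Bool}
    {d : DTree K V} {SL SR : List (Entry K V)} {CL CR : List (STree K V n)} {c l r : STree K V n}
    {k : K} {v : V} {fl : List (Entry K V)} {last : Option ℕ}
    (hlink : Linkage p last d (CL ++ c :: CR))
    (hok : STree.OK p (n + 1) isRoot ⟨addr, d, CL ++ c :: CR⟩)
    (hS : sKeys d.entries = SL ++ SR) (hl : SL.length = CL.length) (hr : SR.length = CR.length)
    (h1 : ∀ x ∈ SL, x.key < e.key) (h2 : ∀ x ∈ SR, e.key < x.key)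
    (hp1 : SL.map Entry.ptr = CL.map (fun c => some (STree.addr n c)))
    (hp2 : SR.map Entry.ptr ++ [last] = (c :: CR).map (fun c => some (STree.addr n c)))
    (hclean : ∀ x ∈ d.entries, x.ptr.isSome)
    (hc : STree.InsertSpec p a h e n false c (.two l k v r, fl)) :
    let d₁ := d.insertS p ⟨k, v, some (STree.addr n l)⟩ (some (STree.addr n r))
    STree.InsertSpec p a h e (n + 1) isRoot ⟨addr, d, CL ++ c :: CR⟩
      (if (sKeys d₁.entries).length ≤ p.f - 1 then (.one ⟨addr, d₁, CL ++ l :: r :: CR⟩, fl)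
        else (splitNode p (a + (n + 1)) addr d₁ (CL ++ l :: r :: CR), fl)) := by
  intro d₁
  obtain ⟨-, -, o3, o4, o5⟩ := hok
  obtain ⟨rfl, c1, c2, c3, c4, c5, c6, c7, c8⟩ := hc
  have hde : d.entries = SL ++ SR := by rw [← hS, sKeys_eq_self hclean]
  have hsep := hlink.sep
  have hl' : (SL.map Entry.key).length = CL.length := by simpa using hl
  have hr' : (SR.map Entry.key).length = CR.length := by simpa using hr
  rw [hS, List.map_append] at hsep
  have hmem : ∀ x ∈ STree.entries n l ++ STree.entries n r,
      x.key = e.key ∨ ∃ y ∈ STree.entries n c, y.key = x.key := by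
    intro x hx
    have hx' : x.key ∈ ((e.key, e.val) :: pairsOf (STree.entries n c)).map Prod.fst := by
      refine (c4.map Prod.fst).mem_iff.1 ?_
      simp only [List.map_append, List.map_cons, map_fst_pairsOf, List.mem_append, List.mem_cons,
        List.mem_map]
      rcases List.mem_append.1 hx with hx | hx
      · exact .inl ⟨x, hx, rfl⟩
      · exact .inr (.inr ⟨x, hx, rfl⟩)
    simpa [map_fst_pairsOf] using hx'
  obtain ⟨hsep', hkl, hkr⟩ := hsep.replace_two (l := l) (r := r) (k := k) hl' hr'
    (by simpa using h1) (by simpa using fun x hx => (h2 x hx).le)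
    (fun x hx => hmem x (by simp [hx])) (fun x hx => hmem x (by simp [hx])) c6 c7
    (c1.entries_ne_nil hf hfs) (c2.entries_ne_nil hf hfs)
  have hkr₀ := hkr
  simp only [List.forall_mem_map] at hkl hkr
  have hins : insertSorted ⟨k, v, some (STree.addr n l)⟩ d.entries =
      SL ++ ⟨k, v, some (STree.addr n l)⟩ :: SR := by
    rw [hde, insertSorted_append hkl hkr]
  have hsomeSR : ∀ x ∈ SR, x.ptr.isSome := fun x hx => hclean x (by simp [hde, hx])
  -- The upper piece keeps the address of `c`, and by linkage that is what the first s-key after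
  -- `k`, or the default, points to.
  have hhi : some (STree.addr n r) = nextPtr (d.entries.filter fun x => k < x.key) last := by
    have := head?_map_ptr_append SR hsomeSR last
    rw [hp2] at this
    rw [hde, List.filter_append, List.filter_eq_nil_iff.2 (by simpa using fun x hx => (hkl x hx).le),
      List.filter_eq_self.2 (by simpa using hkr), List.nil_append, c3]
    simpa using this
  obtain ⟨k1, k2⟩ := hlink.ok.insertS hB hB' (e := ⟨k, v, some (STree.addr n l)⟩) rfl
    (by
      rw [hde]
      intro x hx
      rcases List.mem_append.1 hx with hx | hx
      · exact (hkl x hx).ne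
      · exact (hkr x hx).ne') hhi (.inl rfl)
  rw [hins] at k2
  change d₁.OK p last at k1
  change d₁.entries = _ at k2
  have hsome : ∀ x ∈ d₁.entries, x.ptr.isSome := by
    rw [k2]
    intro x hx
    simp only [List.mem_append, List.mem_cons] at hx
    rcases hx with hx | rfl | hx
    · exact hclean x (by simp [hde, hx])
    · rfl
    · exact hsomeSR x hx
  have hsk := sKeys_eq_self hsome
  have hlink' : Linkage p last d₁ (CL ++ l :: r :: CR) := by
    refine ⟨k1, ?_, ?_⟩
    · rw [hsk, k2]
      simp only [List.map_cons] at hp2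
      simp [hp1, hp2, c3]
    · rw [hsk, k2]
      simpa using hsep'
  have hlen : d₁.entries.length = (sKeys d.entries).length + 1 := by rw [k2, hS]; simp; omega
  have hkids : ∀ z ∈ CL ++ l :: r :: CR, STree.OK p n false z :=
    forall_mem_replace (N := [l, r]) o5 (by simp [c1, c2])
  have hperm : (pairsOf (STree.entries (n + 1) ⟨addr, d₁, CL ++ l :: r :: CR⟩)).Perm
      ((e.key, e.val) :: pairsOf (STree.entries (n + 1) ⟨addr, d, CL ++ c :: CR⟩)) := by
    classical
    simp only [STree.entries, k2, hde, List.flatMap_append, List.flatMap_cons, pairsOf_append,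
      pairsOf_cons, List.perm_iff_count] at c4 ⊢
    intro z
    have := c4 z
    simp only [List.count_append, List.count_cons] at *
    omega
  have haddr : AddrExt a n (STree.addrs (n + 1) ⟨addr, d, CL ++ c :: CR⟩)
      (STree.addrs (n + 1) ⟨addr, d₁, CL ++ l :: r :: CR⟩) := by
    refine c5.context le_rfl (X := addr :: (CL.flatMap (fun c => STree.addrs n c) ++
      CR.flatMap (fun c => STree.addrs n c))) ?_ ?_
    all_goals
      rw [List.perm_iff_count]
      intro z
      simp only [STree.addrs, List.flatMap_append, List.flatMap_cons, List.count_append,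
        List.count_cons]
      omega
  have hpath : ∀ h' y, h ≤ h' → PathClean h' y (n + 1) ⟨addr, d, CL ++ c :: CR⟩ →
      PathClean h' y (n + 1) ⟨addr, d₁, CL ++ l :: r :: CR⟩ := by
    intro h' y hh hy hn
    refine ⟨hsome, fun z hz => ?_⟩
    have hy' := (hy hn).2
    rw [hS, List.map_append] at hy'
    rw [hsk, k2, List.map_append, List.map_cons] at hz
    rcases childFor_replace_two (c := c) hl' hkr₀ hz with ⟨rfl, hyk, hz'⟩ | ⟨rfl, hyk, hz'⟩ | hz'
    · exact (c8 h' y hh (hy' c hz')).1 hyk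
    · exact (c8 h' y hh (hy' c hz')).2 hyk
    · exact hy' z hz'
  rw [hsk]
  split_ifs with hle
  · refine ⟨⟨⟨last, hlink'⟩, ?_, ?_, by rwa [hsk], hkids⟩, rfl, by simpa using hperm,
      haddr.context (Nat.le_succ n) (X := []) (by simp) (by simp), hpath, by simp⟩
    · rw [DTree.size]; omega
    · rw [hsk, hlen]; omega
  · obtain ⟨l', k', v', r', q1, q2, q3, q4, q5, q6, q7, q8, q9⟩ :=
      splitNode_spec hB hB' hf hfs (addr := addr) (a + (n + 1)) hlink' hsome (by omega) hkids
    rw [q1]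
    exact ⟨rfl, q2, q3, q4, q5.trans hperm, haddr.cons q6, q7, q8,
      fun h' y hh hy => q9 h' y (hpath h' y hh hy)⟩

theorem STree.insertAt_spec {p : Params} (hB : 3 ≤ p.B) (hB' : 3 ≤ p.B') (hf : 3 ≤ p.f)
    (hfs : 2 * p.f ≤ p.s) {a h : ℕ} {e : Entry K V} (hp : e.ptr = none) : (n : ℕ) →
    (isRoot : Bool) → (t : STree K V n) → STree.OK p n isRoot t →
    (∀ x ∈ STree.entries n t, x.key ≠ e.key) → ((STree.entries n t).map Entry.key).Nodup →
    (STree.addrs n t).Nodup → PathClean h e.key n t → h ≤ n →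
    STree.InsertSpec p a h e n isRoot t (STree.insertAt p a h e n t)
  | 0, isRoot, ⟨addr, d⟩, hok, he, _, _, _, _ => STree.insertSpec_zero hB hB' hp hok he
  | n + 1, isRoot, ⟨addr, d, cs⟩, hok, he, hnd, hnda, hpc, hn => by
    have hed : ∀ x ∈ d.entries, x.key ≠ e.key := fun x hx => he x (by simp [STree.entries, hx])
    rcases hn.eq_or_lt with rfl | hlt
    · exact STree.insertSpec_here hB hB' hf hfs hp hok hed
    obtain ⟨hclean, hpc'⟩ := hpc hlt
    obtain ⟨last, hlink⟩ := hok.1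
    obtain ⟨SL, SR, CL, c, CR, hS, rfl, hl, hr, h1, h2, hp1, hp2, hroute⟩ := hlink.exists_child hed
    have hsub : ∀ x ∈ STree.entries n c, x ∈ STree.entries (n + 1) ⟨addr, d, CL ++ c :: CR⟩ := by
      intro x hx
      simp [STree.entries, hx]
    simp only [STree.entries, List.flatMap_append, List.flatMap_cons, List.map_append,
      List.nodup_append, List.mem_append] at hnd
    simp only [STree.addrs, List.flatMap_append, List.flatMap_cons, List.nodup_cons,
      List.nodup_append, List.mem_append] at hnda
    have ih := STree.insertAt_spec hB hB' hf hfs (a := a) hp n false c (hok.2.2.2.2 c (by simp))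
      (fun x hx => he x (hsub x hx)) hnd.2.1.2.1.1 hnda.2.2.1.1
      (hpc' c (by
        rw [hS, List.map_append]
        exact childFor_eq_some (by simpa using hl) (by simpa using h1) (by simpa using h2)))
      (by omega)
    have hmem_addr : ∀ {n : ℕ} (t : STree K V n), STree.addr n t ∈ STree.addrs n t := by
      intro n t
      cases n <;> simp [STree.addr, STree.addrs]
    -- Distinct addresses ensure that the search by address does not stop at an earlier sibling.
    have hidx : (CL ++ c :: CR).findIdx (fun z => decide (d.route e.key = some (STree.addr n z))) =
        CL.length := by
      rw [hroute]
      have : CL.findIdx (fun z => decide (some (STree.addr n c) = some (STree.addr n z))) =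
          CL.length := by
        rw [List.findIdx_eq_length]
        intro z hz
        simp only [Option.some.injEq, decide_eq_false_iff_not]
        exact (hnda.2.2.2 _ (List.mem_flatMap.2 ⟨z, hz, hmem_addr z⟩) _ (.inl (hmem_addr c))).symm
      rw [List.findIdx_append, List.findIdx_cons, this]
      simp
    rw [STree.insertAt, if_neg (by omega)]
    simp only [hidx, List.getElem?_append_right, le_refl, Nat.sub_self, List.getElem?_cons_zero]
    rcases hres : STree.insertAt p a h e n c with ⟨c₁ | ⟨l, k, v, r⟩, fl⟩
    · rw [hres] at ih
      simp only [List.set_append_right, le_refl, Nat.sub_self, List.set_cons_zero]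
      refine STree.insertSpec_one hok hS hl h1 h2 hclean (fun x hx y hy => ?_) ih
      exact (hnd.2.2 _ (List.mem_map_of_mem hx) _
        (.inr (.inl (List.mem_map_of_mem hy)))).symm
    · rw [hres] at ih
      have hcs : (CL ++ c :: CR).take CL.length ++ l :: r :: (CL ++ c :: CR).drop (CL.length + 1) =
          CL ++ l :: r :: CR := by
        rw [List.take_left, show CL ++ c :: CR = (CL ++ [c]) ++ CR by simp,
          List.drop_left' (by simp)]
      simp only [hcs]
      exact STree.insertSpec_two hB hB' hf hfs hlink hok hS hl hr h1 h2 hp1 hp2 hclean ih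

end order

/-! ### The whole NB-tree and the recursive insertion -/

theorem le_foldr_max {L : List ℕ} {x : ℕ} (hx : x ∈ L) : x ≤ L.foldr max 0 := by
  induction L with
  | nil => simp at hx
  | cons y L ih =>
    rcases List.mem_cons.1 hx with rfl | hx
    · exact le_max_left _ _
    · exact (ih hx).trans (le_max_right _ _)

theorem NBTree.map_fst_pairs (t : NBTree K V) : t.pairs.map Prod.fst = t.keys := by
  simp [NBTree.pairs, NBTree.keys]

section order

variable [LinearOrder K]

/-- The invariant of an NB-tree, which also admits the initial one. -/
structure NBTree.OK (p : Params) (t : NBTree K V) : Prop where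
  root : STree.OK p t.height true t.root
  keys : t.keys.Nodup
  addrs : (STree.addrs t.height t.root).Nodup

theorem NBTree.insertAt_spec {p : Params} (hB : 3 ≤ p.B) (hB' : 3 ≤ p.B') (hf : 3 ≤ p.f)
    (hfs : 2 * p.f ≤ p.s) {h : ℕ} {e : Entry K V} (hp : e.ptr = none) {t : NBTree K V}
    (ht : t.OK p) (he : e.key ∉ t.keys) (hpc : PathClean h e.key t.height t.root)
    (hh : h ≤ t.height) :
    (t.insertAt p h e).1.OK p ∧ t.height ≤ (t.insertAt p h e).1.height ∧
      ((t.insertAt p h e).1.pairs ++ pairsOf (t.insertAt p h e).2).Perm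
        ((e.key, e.val) :: t.pairs) ∧
      (∀ h' y, h ≤ h' → PathClean h' y t.height t.root →
        PathClean h' y (t.insertAt p h e).1.height (t.insertAt p h e).1.root) ∧
      ∀ x ∈ (t.insertAt p h e).2, x.ptr = none ∧ 1 ≤ h ∧
        PathClean (h - 1) x.key (t.insertAt p h e).1.height (t.insertAt p h e).1.root := by
  have spec := STree.insertAt_spec hB hB' hf hfs
    (a := (STree.addrs t.height t.root).foldr max 0 + 1) hp t.height true t.root ht.root
    (fun x hx hxe => he (hxe ▸ List.mem_map_of_mem hx)) ht.keys ht.addrs hpc hh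
  have hlt : ∀ x ∈ STree.addrs t.height t.root,
      x < (STree.addrs t.height t.root).foldr max 0 + 1 :=
    fun x hx => Nat.lt_succ_of_le (le_foldr_max hx)
  -- Distinctness of keys is inherited through the permutation of pairs, uniformly for both
  -- outcomes.
  have hkeys : ∀ (t' : NBTree K V) (fl : List (Entry K V)),
      (t'.pairs ++ pairsOf fl).Perm ((e.key, e.val) :: t.pairs) → t'.keys.Nodup := by
    intro t' fl hperm
    have := hperm.map Prod.fst
    rw [List.map_append, t'.map_fst_pairs, List.map_cons, t.map_fst_pairs] at this
    exact (List.nodup_append.1 (this.nodup_iff.2 (List.nodup_cons.2 ⟨he, ht.keys⟩))).1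
  unfold NBTree.insertAt
  dsimp only
  generalize (STree.addrs t.height t.root).foldr max 0 + 1 = a at spec hlt
  rcases hres : STree.insertAt p a h e t.height t.root with ⟨t' | ⟨l, k, v, r⟩, fl⟩
  · rw [hres] at spec
    obtain ⟨s1, -, s3, s4, s5, s6⟩ := spec
    exact ⟨⟨s1, hkeys ⟨t.height, t'⟩ fl s3, s4.nodup ht.addrs hlt⟩, le_rfl, s3, s5, s6⟩
  · rw [hres] at spec
    obtain ⟨rfl, s1, s2, -, s3, s4, s5, s6, s7⟩ := spec
    -- The new root's d-tree changes its default from `none` to the address of `r`, which is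
    -- admissible because the empty d-tree has no s-key.
    obtain ⟨k1, k2⟩ := (DTree.OK.empty p none).insertS hB hB'
      (e := (⟨k, v, some (STree.addr t.height l)⟩ : Entry K V)) rfl
      (by simp [DTree.empty, DTree.entries, DNode.entries_zero])
      (hiPtr := some (STree.addr t.height r)) (last' := some (STree.addr t.height r))
      (by simp [DTree.empty, DTree.entries, DNode.entries_zero])
      (.inr (by simp [DTree.empty, DTree.entries, DNode.entries_zero]))
    have k2 : ((DTree.empty none).insertS p ⟨k, v, some (STree.addr t.height l)⟩
        (some (STree.addr t.height r))).entries = [⟨k, v, some (STree.addr t.height l)⟩] := by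
      rw [k2]
      simp [DTree.empty, DTree.entries, DNode.entries_zero, insertSorted]
    dsimp only
    generalize (DTree.empty none).insertS p ⟨k, v, some (STree.addr t.height l)⟩
      (some (STree.addr t.height r)) = d at k1 k2
    have hsk : sKeys d.entries = [⟨k, v, some (STree.addr t.height l)⟩] := by rw [k2]; rfl
    have hperm : (NBTree.pairs ⟨t.height + 1, ⟨a + t.height + 1, d, [l, r]⟩⟩ ++ pairsOf []).Perm
        ((e.key, e.val) :: t.pairs) := by
      refine List.Perm.trans ?_ s3
      simp only [NBTree.pairs, NBTree.entries, STree.entries, k2]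
      simp only [pairsOf, List.map_append, List.flatMap_cons, List.flatMap_nil, List.append_nil,
        List.map_cons, List.map_nil, List.cons_append, List.nil_append]
      exact List.perm_middle.symm
    refine ⟨⟨⟨⟨_, k1, ?_, ?_⟩, ?_, ?_, ?_, ?_⟩, hkeys _ [] hperm, ?_⟩, Nat.le_succ _, hperm,
      ?_, by simp⟩
    · simp [hsk]
    · simpa [hsk, Sep] using ⟨s5, s6⟩
    · simp [DTree.size, k2]; omega
    · simp [hsk]
    · simp [hsk]; omega
    · simp [s1, s2]
    · have h1 := s4.nodup ht.addrs hlt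
      have h2 := s4.le hlt
      simp only [STree.addrs, List.flatMap_cons, List.flatMap_nil, List.append_nil,
        List.nodup_cons]
      exact ⟨fun hx => by have := h2 _ hx; omega, h1⟩
    · intro h' y hh' hy hn
      refine ⟨by simp [k2], fun z hz => ?_⟩
      obtain ⟨p1, p2⟩ := s7 h' y hh' hy
      rw [hsk] at hz
      simp only [List.map_cons, List.map_nil, childFor] at hz
      split_ifs at hz with hyk
      · exact Option.some.inj hz ▸ p1 hyk
      · exact Option.some.inj hz ▸ p2 (not_lt.1 hyk)

/-- What the complete insertion of the entries `es` at height `h` of their search paths achieves. -/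
structure NBTree.RecSpec (p : Params) (h : ℕ) (es : List (Entry K V)) (t t' : NBTree K V) : Prop where
  ok : t'.OK p
  height : t.height ≤ t'.height
  perm : t'.pairs.Perm (pairsOf es ++ t.pairs)
  path : ∀ h' y, h ≤ h' → PathClean h' y t.height t.root → PathClean h' y t'.height t'.root

/-- Two facts about the waiting keys pass from each insertion to the next: their paths stay clean,
by the `path` clause at `h' = h`, and they stay distinct from the stored keys, by the permutation.
-/
theorem NBTree.foldl_spec {p : Params} {h : ℕ} {f : NBTree K V → Entry K V → NBTree K V}
    (hf : ∀ (t : NBTree K V) (e : Entry K V), t.OK p → h ≤ t.height → e.ptr = none →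
      e.key ∉ t.keys → PathClean h e.key t.height t.root → NBTree.RecSpec p h [e] t (f t e))
    (es : List (Entry K V)) (t : NBTree K V) (ht : t.OK p) (hh : h ≤ t.height)
    (hptr : ∀ e ∈ es, e.ptr = none) (hnd : ((pairsOf es ++ t.pairs).map Prod.fst).Nodup)
    (hpc : ∀ e ∈ es, PathClean h e.key t.height t.root) :
    NBTree.RecSpec p h es t (es.foldl f t) := by
  induction es generalizing t with
  | nil => exact ⟨ht, le_rfl, .refl _, fun _ _ _ h => h⟩
  | cons e es ih =>
    have he : e.key ∉ t.keys := by
      rw [← t.map_fst_pairs]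
      simp only [pairsOf_cons, List.cons_append, List.map_cons, List.nodup_cons, List.map_append,
        List.mem_append] at hnd
      exact fun h => hnd.1 (.inr h)
    obtain ⟨a1, a2, a3, a4⟩ := hf t e ht hh (hptr e (by simp)) he (hpc e (by simp))
    have hp : (pairsOf es ++ (f t e).pairs).Perm (pairsOf (e :: es) ++ t.pairs) :=
      (a3.append_left _).trans List.perm_middle
    obtain ⟨b1, b2, b3, b4⟩ := ih (f t e) a1 (hh.trans a2) (fun x hx => hptr x (by simp [hx]))
      ((hp.map _).nodup_iff.2 hnd) fun x hx => a4 _ _ le_rfl (hpc x (by simp [hx]))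
    exact ⟨b1, a2.trans b2, b3.trans hp, fun h' y hh' hy => b4 h' y hh' (a4 h' y hh' hy)⟩

/-- Induction on `h`: the removed keys go to height `h` with paths clean above `h`, and preservation
for all `h' ≥ h` covers the required `h' ≥ h + 1`. -/
theorem NBTree.insertRec_spec {p : Params} (hB : 3 ≤ p.B) (hB' : 3 ≤ p.B') (hf : 3 ≤ p.f)
    (hfs : 2 * p.f ≤ p.s) (h : ℕ) (t : NBTree K V) (e : Entry K V) (ht : t.OK p)
    (hh : h ≤ t.height) (hp : e.ptr = none) (he : e.key ∉ t.keys)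
    (hpc : PathClean h e.key t.height t.root) :
    NBTree.RecSpec p h [e] t (NBTree.insertRec p h e t) := by
  induction h generalizing t e with
  | zero =>
    obtain ⟨a1, a2, a3, a4, a5⟩ := NBTree.insertAt_spec hB hB' hf hfs hp ht he hpc hh
    -- Removed keys exist only for `1 ≤ h`: a leaf s-node is split, never merged.
    have hnil : (t.insertAt p 0 e).2 = [] :=
      List.eq_nil_iff_forall_not_mem.2 fun x hx => absurd (a5 x hx).2.1 (by omega)
    rw [hnil] at a3
    rw [pairsOf_nil, List.append_nil] at a3
    exact ⟨a1, a2, a3, a4⟩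
  | succ h ih =>
    obtain ⟨a1, a2, a3, a4, a5⟩ := NBTree.insertAt_spec hB hB' hf hfs hp ht he hpc hh
    have hp' : (pairsOf (t.insertAt p (h + 1) e).2 ++ (t.insertAt p (h + 1) e).1.pairs).Perm
        (pairsOf [e] ++ t.pairs) := List.perm_append_comm.trans a3
    obtain ⟨b1, b2, b3, b4⟩ := NBTree.foldl_spec (h := h)
      (f := fun t₁ e₁ => NBTree.insertRec p h e₁ t₁) (fun t e h1 h2 h3 h4 => ih t e h1 h2 h3 h4)
      (t.insertAt p (h + 1) e).2 (t.insertAt p (h + 1) e).1 a1 (by omega) (fun x hx => (a5 x hx).1)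
      (by
        refine (hp'.map _).nodup_iff.2 ?_
        simpa [t.map_fst_pairs] using ⟨he, ht.keys⟩)
      fun x hx => (a5 x hx).2.2
    have hpath : ∀ h' y, h + 1 ≤ h' → PathClean h' y t.height t.root →
        PathClean h' y (NBTree.insertRec p (h + 1) e t).height
          (NBTree.insertRec p (h + 1) e t).root :=
      fun h' y hh' hy => b4 h' y (by omega) (a4 h' y hh' hy)
    exact ⟨b1, a2.trans b2, b3.trans hp', hpath⟩

end order

end NBT

/-! ### The main theorem -/

theorem mainTheorem1 {K : Type*} {V : Type*} [LinearOrder K] (p : NBT.Params)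
    (hB : 3 ≤ p.B) (hB' : 3 ≤ p.B') (hf : 3 ≤ p.f) (hfs : 2 * p.f ≤ p.s)
    (t : NBT.NBTree K V)
    (ht : (∃ a : ℕ, t = NBT.NBTree.initial a) ∨
      (t.SizeRequirements p ∧ t.StructuralRequirements p ∧ t.Properties))
    (k : K) (x : V) (hk : k ∉ t.keys) :
    (t.insert p k x).SizeRequirements p ∧
    (t.insert p k x).StructuralRequirements p ∧
    (t.insert p k x).Properties ∧
    ((t.insert p k x).pairs).Perm ((k, x) :: t.pairs) := by
  have hok : t.OK p := by
    rcases ht with ⟨a, rfl⟩ | ⟨h1, ⟨-, h2⟩, h3, h4, h5, h6⟩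
    · refine ⟨⟨NBT.DTree.OK.empty p none, ?_, by simp, ?_⟩, ?_, ?_⟩
      · simp [NBT.DTree.empty, NBT.DTree.entries, NBT.DNode.entries_zero]
      · simp [NBT.DTree.size, NBT.DTree.empty, NBT.DTree.entries, NBT.DNode.entries_zero]
      · simp [NBT.NBTree.keys, NBT.NBTree.entries, NBT.NBTree.initial, NBT.STree.entries,
          NBT.DTree.empty, NBT.DTree.entries, NBT.DNode.entries_zero]
      · simp [NBT.NBTree.initial, NBT.STree.addrs]
    · exact ⟨NBT.STree.OK.of_requirements h1 h2 h3 h6, h4, h5⟩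
  -- The insertion starts at the root's own height, above which there is no s-node, so the path
  -- condition is vacuous.
  obtain ⟨⟨a1, a2, a3⟩, -, a4, -⟩ := NBT.NBTree.insertRec_spec hB hB' hf hfs t.height t
    ⟨k, x, none⟩ hok le_rfl rfl hk (NBT.pathClean_of_le le_rfl)
  change NBT.STree.OK p (t.insert p k x).height true (t.insert p k x).root at a1
  -- The new pair is stored somewhere, which excludes the empty root that the invariant tolerates.
  have hne : NBT.STree.entries (t.insert p k x).height (t.insert p k x).root ≠ [] := by
    intro h0
    have := a4.length_eq
    simp [NBT.NBTree.pairs, NBT.NBTree.entries] at this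
    rw [NBT.NBTree.insert] at h0
    simp [h0] at this
  obtain ⟨b1, b2, b3, b4⟩ := a1.requirements hf hfs hne
  exact ⟨b1, ⟨hfs, b2⟩, ⟨b3, a2, a3, b4⟩, a4⟩
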